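/- For a group $X$ let $\hat X$ denote its profinite completion. For a finitely generated group $\Gamma$ let $\mathrm{Aut}(\hat\Gamma)$ be the group of continuous automorphisms of $\hat\Gamma$ (with the compact-open topology), and let $\widehat{\mathrm{Aut}(\Gamma)}\to \mathrm{Aut}(\hat\Gamma)$ be the natural homomorphism, i.e. the unique continuous homomorphism that sends the image of each $\varphi\in\mathrm{Aut}(\Gamma)$ to the continuous automorphism $\hat\varphi$ of $\hat\Gamma$ induced by $\varphi$. Let $C(\Gamma)$ denote its kernel. For a characteristic subgroup $M\le\Gamma$ of finite index put $G(M)=\ker(\mathrm{Aut}(\Gamma)\to\mathrm{Aut}(\Gamma/M))$; a finite index subgroup of $\mathrm{Aut}(\Gamma)$ is called a congruence subgroup if it contains $G(M)$ for some such $M$. **Theorem.** Let $F_2$ be the free group on two generators. Then $C(F_2)=\{e\}$; that is, $F_2$ has the congruence subgroup property (every finite index subgroup of $\mathrm{Aut}(F_2)$ is a congruence subgroup), namely the natural homomorphism $\widehat{\mathrm{Aut}(F_2)}\to\mathrm{Aut}(\hat F_2)$ is injective. -/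

import Mathlib

namespace CongruenceSubgroupProblem

universe u

section ContinuousAutomorphisms

/-- The group of continuous automorphisms of a topological group, under composition:
`(e₁ * e₂) x = e₁ (e₂ x)`. -/
instance continuousAutGroup (P : Type u) [Group P] [TopologicalSpace P] : Group (P ≃ₜ* P) where
  mul e₁ e₂ := e₂.trans e₁
  one := ContinuousMulEquiv.refl P
  inv e := e.symm
  mul_assoc _ _ _ := rfl
  one_mul _ := rfl
  mul_one _ := rfl
  inv_mul_cancel e := ContinuousMulEquiv.ext fun x => e.symm_apply_apply x

end ContinuousAutomorphisms

section CongruenceSubgroups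

variable {Γ : Type u} [Group Γ]

/-- The natural homomorphism `Aut(Γ) → Aut(Γ/M)` for a characteristic subgroup `M`. -/
def quotientAut (M : Subgroup Γ) [M.Characteristic] : MulAut Γ →* MulAut (Γ ⧸ M) where
  toFun φ := QuotientGroup.congr M M φ (Subgroup.characteristic_iff_map_eq.mp inferInstance φ)
  map_one' := by ext ⟨x⟩; rfl
  map_mul' φ ψ := by ext ⟨x⟩; rfl

/-- The principal congruence subgroup `G(M) = ker (Aut(Γ) → Aut(Γ/M))`. -/
def principalCongruenceSubgroup (M : Subgroup Γ) [M.Characteristic] : Subgroup (MulAut Γ) :=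
  (quotientAut M).ker

/-- A congruence subgroup of `Aut(Γ)` is a finite index subgroup which contains `G(M)` for some
finite index characteristic subgroup `M` of `Γ`. -/
def IsCongruenceSubgroup (H : Subgroup (MulAut Γ)) : Prop :=
  H.FiniteIndex ∧ ∃ (M : Subgroup Γ) (_ : M.Characteristic),
    M.FiniteIndex ∧ principalCongruenceSubgroup M ≤ H

variable (Γ) in
/-- `Γ` has the congruence subgroup property if every finite index subgroup of `Aut(Γ)` is a
congruence subgroup. -/
def HasCongruenceSubgroupProperty : Prop :=
  ∀ H : Subgroup (MulAut Γ), H.FiniteIndex → IsCongruenceSubgroup H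

instance (M : Subgroup Γ) [M.Characteristic] : (principalCongruenceSubgroup M).Normal :=
  inferInstanceAs (quotientAut M).ker.Normal

instance (M : Subgroup Γ) [M.Characteristic] [M.FiniteIndex] :
    (principalCongruenceSubgroup M).FiniteIndex := by
  have : Finite (MulAut (Γ ⧸ M)) := Finite.of_injective _ DFunLike.coe_injective
  exact inferInstanceAs (quotientAut M).ker.FiniteIndex

theorem principalCongruenceSubgroup_mono {L M : Subgroup Γ} [L.Characteristic] [M.Characteristic]
    (h : L ≤ M) : principalCongruenceSubgroup L ≤ principalCongruenceSubgroup M := by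
  intro φ hφ
  change quotientAut M φ = 1
  ext ⟨g⟩
  have hg : ((φ g : Γ) : Γ ⧸ L) = (g : Γ ⧸ L) := congrArg (fun e : MulAut (Γ ⧸ L) => e (g : Γ ⧸ L)) hφ
  exact QuotientGroup.eq.mpr (h (QuotientGroup.eq.mp hg))

/-- The largest characteristic subgroup of `Γ` contained in `N`: the intersection of the
translates of `N` under `Aut(Γ)`. -/
def charCore (N : Subgroup Γ) : Subgroup Γ :=
  ⨅ φ : MulAut Γ, N.comap (φ : Γ →* Γ)

theorem mem_charCore {N : Subgroup Γ} {g : Γ} : g ∈ charCore N ↔ ∀ φ : MulAut Γ, φ g ∈ N := by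
  simp [charCore, Subgroup.mem_iInf]

instance (N : Subgroup Γ) : (charCore N).Characteristic := by
  refine Subgroup.characteristic_iff_le_comap.mpr fun φ g hg => ?_
  rw [Subgroup.mem_comap, mem_charCore]
  intro ψ
  exact mem_charCore.mp hg (ψ * φ)

theorem charCore_le (N : Subgroup Γ) : charCore N ≤ N := fun _ hg => mem_charCore.mp hg 1

theorem charCore_mono {N N' : Subgroup Γ} (h : N ≤ N') : charCore N ≤ charCore N' :=
  fun _ hg => mem_charCore.mpr fun φ => h (mem_charCore.mp hg φ)

/-- In a finitely generated group a normal subgroup of finite index contains a characteristic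
subgroup of finite index. -/
instance [Group.FG Γ] (N : Subgroup Γ) [N.Normal] [N.FiniteIndex] : (charCore N).FiniteIndex := by
  have hfin : Finite (Γ →* Γ ⧸ N) := by
    obtain ⟨S, hS⟩ := Group.FG.out (G := Γ)
    refine Finite.of_injective (fun (f : Γ →* Γ ⧸ N) (s : S) => f s) fun f f' h => ?_
    exact MonoidHom.eq_of_eqOn_dense hS fun s hs => congrFun h ⟨s, hs⟩
  have : (⨅ f : Γ →* Γ ⧸ N, f.ker).FiniteIndex :=
    Subgroup.finiteIndex_iInf fun f => inferInstance
  refine Subgroup.finiteIndex_of_le (H := ⨅ f : Γ →* Γ ⧸ N, f.ker) fun g hg => ?_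
  rw [mem_charCore]
  intro φ
  have := Subgroup.mem_iInf.mp hg ((QuotientGroup.mk' N).comp (φ : Γ →* Γ))
  exact (QuotientGroup.eq_one_iff _).mp this

end CongruenceSubgroups

section Completion

/-- The profinite completion of a group, as a profinite group. -/
abbrev Completion (Γ : Type u) [Group Γ] : ProfiniteGrp.{u} :=
  ProfiniteGrp.ProfiniteCompletion.completion (GrpCat.of Γ)

variable {Γ : Type u} [Group Γ]

/-- The canonical homomorphism from a group to its profinite completion. -/
def toCompletion (Γ : Type u) [Group Γ] : Γ →* Completion Γ :=
  (ProfiniteGrp.ProfiniteCompletion.eta (GrpCat.of Γ)).hom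

/-- The projection of the profinite completion of `Γ` to the finite quotient `Γ/N`. -/
def proj (N : Subgroup Γ) [N.Normal] [N.FiniteIndex] : Completion Γ →* Γ ⧸ N where
  toFun ξ := ξ.1 (FiniteIndexNormalSubgroup.ofSubgroup N)
  map_one' := rfl
  map_mul' _ _ := rfl

theorem proj_toCompletion (N : Subgroup Γ) [N.Normal] [N.FiniteIndex] (g : Γ) :
    proj N (toCompletion Γ g) = (g : Γ ⧸ N) := rfl

theorem proj_ext {ξ ζ : Completion Γ}
    (h : ∀ (N : Subgroup Γ) [N.Normal] [N.FiniteIndex], proj N ξ = proj N ζ) : ξ = ζ :=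
  Subtype.ext (funext fun N => h N.toSubgroup)

theorem proj_eq_of_le {L N : Subgroup Γ} [L.Normal] [L.FiniteIndex] [N.Normal] [N.FiniteIndex]
    (h : L ≤ N) {ξ : Completion Γ} {g : Γ} (hg : proj L ξ = (g : Γ ⧸ L)) :
    proj N ξ = (g : Γ ⧸ N) := by
  have hle : FiniteIndexNormalSubgroup.ofSubgroup L ≤ FiniteIndexNormalSubgroup.ofSubgroup N := h
  have h2 : QuotientGroup.map L N (MonoidHom.id Γ) h (proj L ξ) = proj N ξ := ξ.2 hle.hom
  rw [← h2, hg]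
  rfl

theorem exists_rep (N : Subgroup Γ) [N.Normal] [N.FiniteIndex] (ξ : Completion Γ) :
    ∃ g : Γ, proj N ξ = (g : Γ ⧸ N) :=
  (QuotientGroup.mk_surjective (proj N ξ)).imp fun _ h => h.symm

theorem isOpen_proj_eq (N : Subgroup Γ) [N.Normal] [N.FiniteIndex] (c : Γ ⧸ N) :
    IsOpen {ξ : Completion Γ | proj N ξ = c} := by
  have h : Continuous fun ξ : Completion Γ => ξ.1 (FiniteIndexNormalSubgroup.ofSubgroup N) :=
    (continuous_apply _).comp continuous_subtype_val
  let _ : TopologicalSpace (Γ ⧸ N) := ⊥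
  have _ : DiscreteTopology (Γ ⧸ N) := ⟨rfl⟩
  exact (isOpen_discrete ({c} : Set (Γ ⧸ N))).preimage h

theorem continuous_of_proj {X : Type*} [TopologicalSpace X] {f : X → Completion Γ}
    (h : ∀ (N : Subgroup Γ) [N.Normal] [N.FiniteIndex] (c : Γ ⧸ N),
      IsOpen {x | proj N (f x) = c}) : Continuous f := by
  refine Continuous.subtype_mk (f := fun x => (f x).1) (continuous_pi fun N => ?_) fun x => (f x).2
  let _ : TopologicalSpace (Γ ⧸ N.toSubgroup) := ⊥
  have _ : DiscreteTopology (Γ ⧸ N.toSubgroup) := ⟨rfl⟩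
  have hc : Continuous fun x => proj N.toSubgroup (f x) :=
    continuous_discrete_rng.mpr fun c => h N.toSubgroup c
  exact hc

end Completion

section Action

variable {Γ : Type u} [Group Γ]

/-- The homomorphism from the profinite completion of `Aut(Γ)` to the finite group `Aut(Γ/M)`
induced by `Aut(Γ) → Aut(Γ/M)`, for a finite index characteristic subgroup `M`. -/
def completionQuotientAut (M : Subgroup Γ) [M.Characteristic] [M.FiniteIndex] :
    Completion (MulAut Γ) →* MulAut (Γ ⧸ M) :=
  (QuotientGroup.kerLift (quotientAut M)).comp (proj (principalCongruenceSubgroup M))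

theorem completionQuotientAut_of_rep {L M : Subgroup Γ} [L.Characteristic] [L.FiniteIndex]
    [M.Characteristic] [M.FiniteIndex] (h : L ≤ M) {x : Completion (MulAut Γ)} {φ : MulAut Γ}
    (hφ : proj (principalCongruenceSubgroup L) x =
      (φ : MulAut Γ ⧸ principalCongruenceSubgroup L)) (g : Γ) :
    completionQuotientAut M x (g : Γ ⧸ M) = ((φ g : Γ) : Γ ⧸ M) := by
  have h1 := proj_eq_of_le (principalCongruenceSubgroup_mono h) hφ
  change QuotientGroup.kerLift (quotientAut M) (proj (principalCongruenceSubgroup M) x) _ = _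
  rw [h1]
  rfl

variable [Group.FG Γ]

/-- The component in `Γ/N` of the action of the profinite completion of `Aut(Γ)` on that of `Γ`:
`x` acts on the component of `ξ` in `Γ/M`, and the result is projected to `Γ/N`, where `M` is the
finite index characteristic subgroup `charCore N` of `N`. -/
def actComponent (x : Completion (MulAut Γ)) (ξ : Completion Γ) (N : Subgroup Γ) [N.Normal]
    [N.FiniteIndex] : Γ ⧸ N :=
  QuotientGroup.map (charCore N) N (MonoidHom.id Γ) (charCore_le N)
    (completionQuotientAut (charCore N) x (proj (charCore N) ξ))

theorem actComponent_of_rep {L N : Subgroup Γ} [L.Characteristic] [L.FiniteIndex] [N.Normal]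
    [N.FiniteIndex] (h : L ≤ charCore N) {x : Completion (MulAut Γ)} {ξ : Completion Γ}
    {φ : MulAut Γ} {g : Γ}
    (hφ : proj (principalCongruenceSubgroup L) x =
      (φ : MulAut Γ ⧸ principalCongruenceSubgroup L))
    (hg : proj L ξ = (g : Γ ⧸ L)) :
    actComponent x ξ N = ((φ g : Γ) : Γ ⧸ N) := by
  rw [actComponent, proj_eq_of_le h hg, completionQuotientAut_of_rep h hφ]
  rfl

theorem actComponent_compatible (x : Completion (MulAut Γ)) (ξ : Completion Γ)
    {N N' : Subgroup Γ} [N.Normal] [N.FiniteIndex] [N'.Normal] [N'.FiniteIndex] (h : N ≤ N') :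
    QuotientGroup.map N N' (MonoidHom.id Γ) h (actComponent x ξ N) = actComponent x ξ N' := by
  obtain ⟨φ, hφ⟩ := exists_rep (principalCongruenceSubgroup (charCore N)) x
  obtain ⟨g, hg⟩ := exists_rep (charCore N) ξ
  rw [actComponent_of_rep le_rfl hφ hg, actComponent_of_rep (charCore_mono h) hφ hg]
  rfl

/-- The action of the profinite completion of `Aut(Γ)` on that of `Γ`. -/
def act (x : Completion (MulAut Γ)) (ξ : Completion Γ) : Completion Γ :=
  ⟨fun N => actComponent x ξ N.toSubgroup, fun _ _ h => actComponent_compatible x ξ h.le⟩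

theorem proj_act_of_rep {L N : Subgroup Γ} [L.Characteristic] [L.FiniteIndex] [N.Normal]
    [N.FiniteIndex] (h : L ≤ charCore N) {x : Completion (MulAut Γ)} {ξ : Completion Γ}
    {φ : MulAut Γ} {g : Γ}
    (hφ : proj (principalCongruenceSubgroup L) x =
      (φ : MulAut Γ ⧸ principalCongruenceSubgroup L))
    (hg : proj L ξ = (g : Γ ⧸ L)) :
    proj N (act x ξ) = ((φ g : Γ) : Γ ⧸ N) :=
  actComponent_of_rep h hφ hg

theorem act_one (ξ : Completion Γ) : act 1 ξ = ξ := by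
  refine proj_ext fun N _ _ => ?_
  obtain ⟨g, hg⟩ := exists_rep (charCore N) ξ
  rw [proj_act_of_rep (L := charCore N) (φ := 1) le_rfl rfl hg,
    proj_eq_of_le (charCore_le N) hg]
  rfl

theorem act_mul (x y : Completion (MulAut Γ)) (ξ : Completion Γ) :
    act (x * y) ξ = act x (act y ξ) := by
  refine proj_ext fun N _ _ => ?_
  let L := charCore (charCore N)
  have hL : L ≤ charCore N := charCore_le _
  obtain ⟨g, hg⟩ := exists_rep L ξ
  obtain ⟨φ, hφ⟩ := exists_rep (principalCongruenceSubgroup L) x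
  obtain ⟨ψ, hψ⟩ := exists_rep (principalCongruenceSubgroup L) y
  have hφψ : proj (principalCongruenceSubgroup L) (x * y) =
      ((φ * ψ : MulAut Γ) : MulAut Γ ⧸ principalCongruenceSubgroup L) := by
    rw [map_mul, hφ, hψ]
    rfl
  have h1 : proj (charCore N) (act y ξ) = ((ψ g : Γ) : Γ ⧸ charCore N) :=
    proj_act_of_rep le_rfl hψ hg
  have h2 := proj_eq_of_le (principalCongruenceSubgroup_mono hL) hφ
  rw [proj_act_of_rep hL hφψ hg, proj_act_of_rep le_rfl h2 h1]
  rfl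

theorem act_map_mul (x : Completion (MulAut Γ)) (ξ ζ : Completion Γ) :
    act x (ξ * ζ) = act x ξ * act x ζ := by
  refine proj_ext fun N _ _ => ?_
  obtain ⟨φ, hφ⟩ := exists_rep (principalCongruenceSubgroup (charCore N)) x
  obtain ⟨g, hg⟩ := exists_rep (charCore N) ξ
  obtain ⟨k, hk⟩ := exists_rep (charCore N) ζ
  have hgk : proj (charCore N) (ξ * ζ) = ((g * k : Γ) : Γ ⧸ charCore N) := by
    rw [map_mul, hg, hk]
    rfl
  rw [map_mul, proj_act_of_rep le_rfl hφ hg, proj_act_of_rep le_rfl hφ hk,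
    proj_act_of_rep le_rfl hφ hgk, map_mul]
  rfl

theorem continuous_act_uncurry :
    Continuous fun p : Completion (MulAut Γ) × Completion Γ => act p.1 p.2 := by
  refine continuous_of_proj fun N _ _ c => isOpen_iff_mem_nhds.mpr fun p hp => ?_
  have h1 := (isOpen_proj_eq (principalCongruenceSubgroup (charCore N)) (proj _ p.1)).mem_nhds rfl
  have h2 := (isOpen_proj_eq (charCore N) (proj _ p.2)).mem_nhds rfl
  refine Filter.mem_of_superset (prod_mem_nhds h1 h2) ?_
  rintro ⟨y, ζ⟩ ⟨hy, hζ⟩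
  obtain ⟨φ, hφ⟩ := exists_rep (principalCongruenceSubgroup (charCore N)) p.1
  obtain ⟨g, hg⟩ := exists_rep (charCore N) p.2
  have hp' : proj N (act p.1 p.2) = c := hp
  change proj N (act y ζ) = c
  rw [← hp', proj_act_of_rep le_rfl hφ hg,
    proj_act_of_rep le_rfl (Eq.trans hy hφ) (Eq.trans hζ hg)]

theorem continuous_act (x : Completion (MulAut Γ)) : Continuous (act x) :=
  continuous_act_uncurry.comp (Continuous.prodMk_right x)

variable (Γ) in
/-- The natural homomorphism from the profinite completion of `Aut(Γ)` to the group of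
continuous automorphisms of the profinite completion of `Γ`, for a finitely generated group `Γ`.
It is characterized by `completionAutMap_toCompletion` and `continuous_completionAutMap`. -/
def completionAutMap : Completion (MulAut Γ) →* (Completion Γ ≃ₜ* Completion Γ) where
  toFun x :=
    { toFun := act x
      invFun := act x⁻¹
      left_inv := fun ξ => by rw [← act_mul, inv_mul_cancel, act_one]
      right_inv := fun ξ => by rw [← act_mul, mul_inv_cancel, act_one]
      map_mul' := act_map_mul x
      continuous_toFun := continuous_act x
      continuous_invFun := continuous_act x⁻¹ }
  map_one' := ContinuousMulEquiv.ext act_one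
  map_mul' x y := ContinuousMulEquiv.ext (act_mul x y)

/-- On `Aut(Γ)` the natural homomorphism is `φ ↦ φ̂`: the image of `φ` is the continuous
automorphism of the profinite completion of `Γ` that extends `φ`. -/
theorem completionAutMap_toCompletion (φ : MulAut Γ) (g : Γ) :
    completionAutMap Γ (toCompletion (MulAut Γ) φ) (toCompletion Γ g) = toCompletion Γ (φ g) :=
  proj_ext fun N _ _ => proj_act_of_rep (L := charCore N) le_rfl rfl rfl

/-- The natural homomorphism is continuous (for the compact-open topology on the continuous
automorphisms of the profinite completion of `Γ`). -/
theorem continuous_completionAutMap :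
    Continuous fun p : Completion (MulAut Γ) × Completion Γ => completionAutMap Γ p.1 p.2 :=
  continuous_act_uncurry

variable (Γ) in
/-- The congruence kernel `C(Γ)` of a finitely generated group `Γ`. -/
def congruenceKernel : Subgroup (Completion (MulAut Γ)) :=
  (completionAutMap Γ).ker

end Action

end CongruenceSubgroupProblem

/-!
# The congruence subgroup property of the free group on two generators

The group `F = ⟨x, y⟩` is the fundamental group of the once punctured torus. Dividing by the
hyperelliptic involution and passing to the cover given by multiplication by two turns it, up to
finite index, into the fundamental group of a sphere with four punctures, and `Aut F` becomes,
up to finite index, the pure mapping class group `E` of the sphere with five punctures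
(`BraidExt`), where the fifth puncture is the base point. One has to show that an element of `E`
which commutes with all pushes of the base point, modulo a small enough finite index subgroup,
lies in a given finite index subgroup.

The point is that `E` is free-by-free in several ways. Forgetting one of the four punctures, `p`,
instead of the base point gives `E = N ⋊ Φ` with `N` free on three and `Φ` free on two generators,
where `N` consists of the pushes of `p`, and the generators of `Φ` are pushes of the base point. If
`g` in `E` commutes with those in a finite quotient, then its image in `Φ` is central in a finite
quotient of `Φ`, hence small, because free groups have many finite quotients with small centre. So
`g` is essentially in `N`. It also commutes with the loop of the base point around `p`. This loop is
at the same time one of the free generators of `N`, and an element of `N` which commutes with it and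
with a conjugate of it in a suitable finite quotient is small as well. Both facts about finite
quotients of free groups are `FreeGroup.exists_normal_commute_imp_mem`, which is proved with
explicit permutation representations, and `FreeGroupTwo.exists_commutator_detection` is the
resulting statement about `E`. Squares of the loops are used there, because only those act on `F`
by inner automorphisms, while the loops themselves involve the hyperelliptic involution.

To transport this to `Aut F` one needs that the pushes of the base point embed into `Aut F`
(`FreeGroupTwo.punctureAut_injective`), and that the image of `E` contains a principal congruence
subgroup. For the latter, Nielsen's theorem (`FreeGroupTwo.eq_top_of_elementary_mem`), proved by
minimising the lengths of the images of the generators, identifies the group generated by `E` and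
the inner automorphisms with a group defined by the action on the abelianization
(`FreeGroupTwo.levelTwo_eq`). The four cosets of the image of `E` in that group permute the
punctures, so they are separated by the action on `F` modulo a small subgroup too.
-/

/-! ### Principal congruence subgroups -/

namespace CongruenceSubgroupProblem

theorem mem_principalCongruenceSubgroup_iff {Γ : Type*} [Group Γ] {M : Subgroup Γ}
    [M.Characteristic] {φ : MulAut Γ} :
    φ ∈ principalCongruenceSubgroup M ↔ ∀ g, φ g * g⁻¹ ∈ M := by
  have h1 : ∀ g : Γ, quotientAut M φ (g : Γ ⧸ M) = (φ g : Γ) := fun g => rfl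
  refine ⟨fun h g => ?_, fun h => ?_⟩
  · have h2 : quotientAut M φ = 1 := h
    have h3 := h1 g
    rw [h2, MulAut.one_apply] at h3
    rw [← QuotientGroup.eq_one_iff, QuotientGroup.mk_mul, QuotientGroup.mk_inv, ← h3,
      mul_inv_cancel]
  · refine MulEquiv.ext fun q => ?_
    obtain ⟨g, rfl⟩ := QuotientGroup.mk_surjective q
    rw [h1, MulAut.one_apply, ← mul_inv_eq_one, ← QuotientGroup.mk_inv, ← QuotientGroup.mk_mul]
    exact (QuotientGroup.eq_one_iff _).mpr (h g)

end CongruenceSubgroupProblem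

/-! ### Cancellation in free groups -/

namespace FreeGroup

variable {α : Type*} [DecidableEq α]

/-- The number of letters, counted in both factors, which cancel in the product `g⁻¹ * h` of
reduced words. This is twice the Gromov product of `g` and `h`, hence twice the length of their
longest common prefix. -/
def cancel (g h : FreeGroup α) : ℤ := (norm g : ℤ) + norm h - norm (g⁻¹ * h)

theorem IsReduced.invRev {l : List (α × Bool)} (h : IsReduced l) : IsReduced (invRev l) := by
  rw [isReduced_iff_reduce_eq, reduce_invRev, h.reduce_eq]

theorem isReduced_invRev_append_cons {a b : α × Bool} {l₁ l₂ : List (α × Bool)}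
    (h₁ : IsReduced (a :: l₁)) (h₂ : IsReduced (b :: l₂)) (hab : a ≠ b) :
    IsReduced (invRev (a :: l₁) ++ (b :: l₂)) := by
  have h3 : IsReduced (invRev (a :: l₁)) := h₁.invRev
  have : invRev (a :: l₁) = invRev l₁ ++ [(a.1, !a.2)] := by simp [invRev]
  rw [this] at h3 ⊢
  refine IsReduced.append_overlap (L₃ := b :: l₂) h3 ?_ (by simp)
  rw [List.singleton_append]
  refine List.isChain_cons_cons.mpr ⟨fun h => ?_, h₂⟩
  obtain ⟨a1, a2⟩ := a
  obtain ⟨b1, b2⟩ := b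
  simp at h ⊢
  subst h
  cases a2 <;> cases b2 <;> simp_all

/-- The length of the longest common prefix of two words. -/
def lcp : List (α × Bool) → List (α × Bool) → ℕ
  | a :: l, b :: k => if a = b then lcp l k + 1 else 0
  | _, _ => 0

theorem lcp_ultra (l k m : List (α × Bool)) : min (lcp l k) (lcp k m) ≤ lcp l m := by
  induction l generalizing k m with
  | nil => cases k <;> simp [lcp]
  | cons a l ih =>
    cases k with
    | nil => simp [lcp]
    | cons b k =>
      cases m with
      | nil => simp [lcp]
      | cons c m =>
        have := ih k m
        simp only [lcp]
        split_ifs <;> simp_all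

theorem length_reduce_invRev_append {l k : List (α × Bool)} (hl : IsReduced l)
    (hk : IsReduced k) :
    ((reduce (invRev l ++ k)).length : ℤ) = l.length + k.length - 2 * lcp l k := by
  induction l generalizing k with
  | nil => simp [lcp, hk.reduce_eq]
  | cons a l ih =>
    cases k with
    | nil =>
      simp [lcp, hl.invRev.reduce_eq]
    | cons b k =>
      by_cases hab : a = b
      · subst hab
        have h1 : reduce (invRev (a :: l) ++ a :: k) = reduce (invRev l ++ k) := by
          apply reduce.Step.eq
          have : invRev (a :: l) ++ a :: k = invRev l ++ ((a.1, !a.2) :: (a.1, !!a.2) :: k) := by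
            simp [invRev]
          rw [this]
          exact Red.Step.not
        rw [h1, ih (List.isChain_of_isChain_cons hl) (List.isChain_of_isChain_cons hk)]
        simp [lcp]
        ring
      · rw [(isReduced_invRev_append_cons hl hk hab).reduce_eq]
        simp [lcp, hab]

theorem cancel_eq (g h : FreeGroup α) : cancel g h = 2 * lcp g.toWord h.toWord := by
  have := length_reduce_invRev_append (isReduced_toWord (x := g)) (isReduced_toWord (x := h))
  rw [cancel, norm, norm, norm, toWord_mul, toWord_inv, this]
  ring

/-- The Cayley tree is `0`-hyperbolic: the Gromov product is an ultrametric. -/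
theorem min_cancel_le (g h k : FreeGroup α) : min (cancel g h) (cancel h k) ≤ cancel g k := by
  have := lcp_ultra g.toWord h.toWord k.toWord
  simp only [cancel_eq]
  omega

theorem cancel_comm (g h : FreeGroup α) : cancel g h = cancel h g := by
  rw [cancel, cancel, ← norm_inv_eq (x := g⁻¹ * h)]
  simp
  ring

theorem norm_mul_eq (g h : FreeGroup α) : (norm (g * h) : ℤ) = norm g + norm h - cancel g⁻¹ h := by
  simp [cancel]

theorem norm_lt_norm_mul_self {g : FreeGroup α} (hg : g ≠ 1) : norm g < norm (g * g) := by
  have h1 := reduceCyclically.reduce_flatten_replicate_succ (isReduced_toWord (x := g)) 1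
  have h0 := reduceCyclically.reduce_flatten_replicate_succ (isReduced_toWord (x := g)) 0
  rw [show (List.replicate (1 + 1) g.toWord).flatten = g.toWord ++ g.toWord by
    simp [List.replicate], ← toWord_mul] at h1
  rw [show (List.replicate (0 + 1) g.toWord).flatten = g.toWord by
    simp, reduce_toWord] at h0
  have e1 := congrArg List.length h1
  have e0 := congrArg List.length h0
  have hne : (reduceCyclically g.toWord).length ≠ 0 := by
    intro h
    have h' : reduceCyclically g.toWord = [] := List.length_eq_zero_iff.mp h
    have := reduceCyclically.conj_conjugator_reduceCyclically g.toWord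
    rw [h'] at this
    apply hg
    rw [← mk_toWord (x := g), ← this]
    simp [← mul_mk, ← inv_mk]
  simp only [List.replicate_succ, List.replicate_zero, List.flatten_cons, List.flatten_nil,
    List.length_append, List.append_nil, zero_add, Nat.reduceAdd] at e0 e1
  rw [norm, norm]
  omega

/-- A prefix of `g` of given length. -/
theorem exists_norm_inv_mul {g : FreeGroup α} {m : ℕ} (hm : m ≤ norm g) :
    ∃ q : FreeGroup α, norm q = m ∧ norm (q⁻¹ * g) = norm g - m := by
  have hr : IsReduced (g.toWord.take m ++ g.toWord.drop m) := by
    rw [List.take_append_drop]; exact isReduced_toWord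
  refine ⟨mk (g.toWord.take m), ?_, ?_⟩
  · rw [norm, toWord_mk, IsReduced.reduce_eq (List.IsChain.left_of_append hr)]
    simp
    exact hm
  · have : (mk (g.toWord.take m))⁻¹ * g = mk (g.toWord.drop m) := by
      rw [inv_mul_eq_iff_eq_mul, mul_mk, List.take_append_drop, mk_toWord]
    rw [this, norm, toWord_mk, IsReduced.reduce_eq (List.IsChain.right_of_append hr)]
    simp [norm]

theorem even_cancel (g h : FreeGroup α) : ∃ c : ℕ, cancel g h = 2 * c := ⟨_, cancel_eq g h⟩

/-- If in every product `f i * f j * f k` of admissible neighbours some letter of the middle factor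
survives, then some letter of each factor survives in every admissible product, which is
therefore at least as long as its number of factors. -/
theorem length_le_norm_prod {ι : Type*} {r : ι → ι → Prop} (hr : ∀ i, r i i)
    {f : ι → FreeGroup α}
    (h : ∀ i j k, r i j → r j k →
      cancel (f i)⁻¹ (f j) + cancel (f j)⁻¹ (f k) < 2 * norm (f j))
    {l : List ι} (hl : l.IsChain r) : l.length ≤ norm (l.map f).prod := by
  -- The first factor `f i` of a product is seen by a left neighbour `f k` as if it stood alone;
  -- the term `cancel (f k)⁻¹ (f i)` in the length estimate pays for the next factor on the left.
  suffices H : ∀ (l : List ι) (i : ι), (i :: l).IsChain r → ∀ k, r k i →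
      cancel (f k)⁻¹ ((i :: l).map f).prod = cancel (f k)⁻¹ (f i) ∧
      2 * ((i :: l).length : ℤ) + cancel (f k)⁻¹ (f i) ≤ 2 * norm ((i :: l).map f).prod by
    cases l with
    | nil => simp
    | cons i l =>
      have := (H l i hl i (hr i)).2
      obtain ⟨c, hc⟩ := even_cancel (f i)⁻¹ (f i)
      omega
  intro l
  induction l with
  | nil =>
    intro i _ k hk
    obtain ⟨c, hc⟩ := even_cancel (f k)⁻¹ (f i)
    obtain ⟨d, hd⟩ := even_cancel (f i)⁻¹ (f i)
    have := h k i i hk (hr i)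
    simp
    omega
  | cons j l ih =>
    intro i hl k hk
    obtain ⟨hij, hl'⟩ := List.isChain_cons_cons.mp hl
    obtain ⟨h1, h2⟩ := ih j hl' i hij
    set Q := ((j :: l).map f).prod
    have hP : ((i :: j :: l).map f).prod = f i * Q := List.prod_cons
    rw [hP]
    have h3 := h k i j hk hij
    have h4 := norm_mul_eq (f i) Q
    have h5 : cancel (f i) (f i * Q) = norm (f i) + norm (f i * Q) - norm Q := by simp [cancel]
    have h6 := min_cancel_le (f k)⁻¹ (f i) (f i * Q)
    have h7 := min_cancel_le (f k)⁻¹ (f i * Q) (f i)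
    rw [cancel_comm (f i * Q)] at h7
    obtain ⟨c, hc⟩ := even_cancel (f k)⁻¹ (f i)
    obtain ⟨d, hd⟩ := even_cancel (f i)⁻¹ (f j)
    rw [List.length_cons]
    push_cast
    constructor <;> omega

end FreeGroup

/-! ### Generators of the automorphism group -/

namespace FreeGroup

/-- The automorphism of a free group with `of i ↦ f i` whose inverse is `of i ↦ g i`. -/
def autOfImages {ι : Type*} (f g : ι → FreeGroup ι) (hgf : ∀ i, lift g (f i) = of i)
    (hfg : ∀ i, lift f (g i) = of i) : MulAut (FreeGroup ι) :=
  MonoidHom.toMulEquiv (lift f) (lift g) (by ext i; simp [hgf]) (by ext i; simp [hfg])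

@[simp]
theorem autOfImages_of {ι : Type*} (f g : ι → FreeGroup ι) (hgf hfg) (i : ι) :
    autOfImages f g hgf hfg (of i) = f i := by
  simp [autOfImages]

theorem mulAut_ext {ι : Type*} {φ ψ : MulAut (FreeGroup ι)} (h : ∀ i, φ (of i) = ψ (of i)) :
    φ = ψ := by
  have : φ.toMonoidHom = ψ.toMonoidHom := by ext i; exact h i
  ext g
  exact DFunLike.congr_fun this g

end FreeGroup

namespace FreeGroupTwo

open FreeGroup hiding map_mul map_inv map_one

/-- The automorphism `x ↦ y`, `y ↦ x`, where `x = of 0` and `y = of 1`. -/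
def swapAut : MulAut (FreeGroup (Fin 2)) :=
  autOfImages ![of 1, of 0] ![of 1, of 0] (by decide) (by decide)

/-- The automorphism `x ↦ x⁻¹`, `y ↦ y`. -/
def invertAut : MulAut (FreeGroup (Fin 2)) :=
  autOfImages ![(of 0)⁻¹, of 1] ![(of 0)⁻¹, of 1] (by decide) (by decide)

/-- The automorphism `x ↦ x * y`, `y ↦ y`. -/
def transvectAut : MulAut (FreeGroup (Fin 2)) :=
  autOfImages ![of 0 * of 1, of 1] ![of 0 * (of 1)⁻¹, of 1] (by decide) (by decide)

@[simp] theorem swapAut_zero : swapAut (of 0) = of 1 := by simp [swapAut]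
@[simp] theorem swapAut_one : swapAut (of 1) = of 0 := by simp [swapAut]
@[simp] theorem invertAut_zero : invertAut (of 0) = (of 0)⁻¹ := by simp [invertAut]
@[simp] theorem invertAut_one : invertAut (of 1) = of 1 := by simp [invertAut]
@[simp] theorem transvectAut_zero : transvectAut (of 0) = of 0 * of 1 := by simp [transvectAut]
@[simp] theorem transvectAut_one : transvectAut (of 1) = of 1 := by simp [transvectAut]

/-- The Nielsen moves which replace one generator by its product with the other, up to signs. -/
theorem exists_mem_elementary {D : Subgroup (MulAut (FreeGroup (Fin 2)))} (hs : swapAut ∈ D)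
    (he : invertAut ∈ D) (ht : transvectAut ∈ D) {i j : Fin 2} (hij : i ≠ j) (b c : Bool) :
    ∃ d ∈ D, d (of i) = cond b (of i) (of i)⁻¹ * cond c (of j) (of j)⁻¹ ∧ d (of j) = of j := by
  have he' := D.mul_mem (D.mul_mem hs he) hs
  have h0 : ∃ d ∈ D, d (of 0) = cond b (of 0) (of 0)⁻¹ * cond c (of 1) (of 1)⁻¹ ∧
      d (of 1) = of 1 := by
    have ht' := D.mul_mem (D.mul_mem he' ht) he'
    cases b <;> cases c
    · exact ⟨_, D.mul_mem he ht', by simp, by simp⟩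
    · exact ⟨_, D.mul_mem he ht, by simp, by simp⟩
    · exact ⟨_, ht', by simp, by simp⟩
    · exact ⟨_, ht, by simp, by simp⟩
  obtain ⟨d, hd, h1, h2⟩ := h0
  fin_cases i <;> fin_cases j
  · exact absurd rfl hij
  · exact ⟨d, hd, h1, h2⟩
  · refine ⟨_, D.mul_mem (D.mul_mem hs hd) hs, ?_, ?_⟩
    · cases b <;> cases c <;> simp [h1]
    · simp [h2]
  · exact absurd rfl hij

theorem exists_mem_signedPerm {D : Subgroup (MulAut (FreeGroup (Fin 2)))} (hs : swapAut ∈ D)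
    (he : invertAut ∈ D) {i j : Fin 2} (hij : i ≠ j) (b c : Bool) :
    ∃ d ∈ D, d (of 0) = cond b (of i) (of i)⁻¹ ∧ d (of 1) = cond c (of j) (of j)⁻¹ := by
  have he' := D.mul_mem (D.mul_mem hs he) hs
  have h0 : ∃ d ∈ D, d (of 0) = cond b (of 0) (of 0)⁻¹ ∧ d (of 1) = cond c (of 1) (of 1)⁻¹ := by
    cases b <;> cases c
    · exact ⟨_, D.mul_mem he he', by simp, by simp⟩
    · exact ⟨_, he, by simp, by simp⟩
    · exact ⟨_, he', by simp, by simp⟩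
    · exact ⟨1, D.one_mem, by simp, by simp⟩
  obtain ⟨d, hd, h1, h2⟩ := h0
  fin_cases i <;> fin_cases j
  · exact absurd rfl hij
  · exact ⟨d, hd, h1, h2⟩
  · refine ⟨_, D.mul_mem hs hd, ?_, ?_⟩
    · cases b <;> simp [h1]
    · cases c <;> simp [h2]
  · exact absurd rfl hij

/-- The total length of the images of the two generators. -/
def size (φ : MulAut (FreeGroup (Fin 2))) : ℕ := norm (φ (of 0)) + norm (φ (of 1))

theorem size_eq (φ : MulAut (FreeGroup (Fin 2))) {i j : Fin 2} (hij : i ≠ j) :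
    size φ = norm (φ (of i)) + norm (φ (of j)) := by
  fin_cases i <;> fin_cases j <;> simp_all [size, add_comm]

/-- The case of exact half cancellation. If half of `b` cancels against `a` on either side, then
`b = r * q⁻¹` and `a = q * a' * r⁻¹` with `r`, `q` of the same length, so that conjugation by `q`
turns `(a * b, b)` into the shorter pair `(a', q⁻¹ * r)`. -/
theorem exists_conj_norm_add_lt {a b : FreeGroup (Fin 2)} (hb : b ≠ 1)
    (hab : (norm b : ℤ) ≤ norm a)
    (h1 : cancel a⁻¹ b = norm b) (h2 : cancel b⁻¹ a = norm b) :
    ∃ q : FreeGroup (Fin 2), norm (q⁻¹ * (a * b) * q) + norm (q⁻¹ * b * q) < norm a + norm b := by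
  obtain ⟨m, hm⟩ := even_cancel a⁻¹ b
  have hb0 : norm b ≠ 0 := by simpa using hb
  obtain ⟨q, hq, hqb⟩ := exists_norm_inv_mul (g := b⁻¹) (m := m) (by rw [norm_inv_eq]; omega)
  rw [norm_inv_eq] at hqb
  have hr : norm (b * q) = m := by
    rw [← norm_inv_eq, mul_inv_rev]; omega
  have e1 : cancel b (b * q) = 2 * m := by simp only [cancel, inv_mul_cancel_left]; omega
  have e2 : cancel q b⁻¹ = 2 * m := by simp only [cancel, norm_inv_eq]; omega
  have e3 := min_cancel_le a⁻¹ b (b * q)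
  have e4 := min_cancel_le q b⁻¹ a
  have e5 := norm_mul_eq a (b * q)
  have e6 : cancel a (a * (b * q)) = norm a + norm (a * (b * q)) - norm (b * q) := by
    simp [cancel]
  have e7 := min_cancel_le q a (a * (b * q))
  have e8 := norm_mul_eq q⁻¹ (a * (b * q))
  have e9 := norm_mul_le q⁻¹ (b * q)
  have e10 := norm_mul_le (a * (b * q)) (b * q)⁻¹
  rw [mul_inv_cancel_right] at e10
  rw [inv_inv] at e8
  rw [norm_inv_eq] at e8 e9 e10
  refine ⟨q, ?_⟩
  rw [mul_assoc, mul_assoc, mul_assoc]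
  omega

/-- If no Nielsen moves and conjugations, composed in any way, shorten the pair of images of the
generators under `ψ`, then `ψ` does not decrease lengths. -/
theorem norm_le_norm_apply_of_minimal {D : Subgroup (MulAut (FreeGroup (Fin 2)))}
    (hs : swapAut ∈ D) (he : invertAut ∈ D) (ht : transvectAut ∈ D)
    (hc : ∀ g, MulAut.conj g ∈ D) {ψ : MulAut (FreeGroup (Fin 2))}
    (hψ : ∀ d ∈ D, size ψ ≤ size (ψ * d)) (w : FreeGroup (Fin 2)) : norm w ≤ norm (ψ w) := by
  let f : Fin 2 × Bool → FreeGroup (Fin 2) := fun p => cond p.2 (ψ (of p.1)) (ψ (of p.1))⁻¹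
  have hf1 : ∀ p, f p ≠ 1 := by rintro ⟨i, b⟩; cases b <;> simp [f]
  have hf : ∀ p, f p = ψ (cond p.2 (of p.1) (of p.1)⁻¹) := by
    rintro ⟨i, b⟩; cases b <;> simp [f]
  have hfn : ∀ p, norm (f p) = norm (ψ (of p.1)) := by rintro ⟨i, b⟩; cases b <;> simp [f]
  have hfinv : ∀ p, (f p)⁻¹ = f (p.1, !p.2) := by rintro ⟨i, b⟩; cases b <;> simp [f]
  have hle : ∀ p q : Fin 2 × Bool, p.1 ≠ q.1 → norm (f p) ≤ norm (f p * f q) := by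
    intro p q hpq
    obtain ⟨d, hd, h1, h2⟩ := exists_mem_elementary hs he ht hpq p.2 q.2
    have := hψ d hd
    rw [size_eq ψ hpq, size_eq _ hpq, MulAut.mul_apply, MulAut.mul_apply, h1, h2, map_mul, ← hf,
      ← hf] at this
    rw [hfn]
    omega
  have hle' : ∀ p q : Fin 2 × Bool, p.1 ≠ q.1 → norm (f q) ≤ norm (f p * f q) := by
    intro p q hpq
    have := hle (q.1, !q.2) (p.1, !p.2) hpq.symm
    rwa [← hfinv, ← hfinv, ← mul_inv_rev, norm_inv_eq, norm_inv_eq] at this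
  have hself : ∀ p, cancel (f p)⁻¹ (f p) < norm (f p) := by
    intro p
    have := norm_lt_norm_mul_self (hf1 p)
    have := norm_mul_eq (f p) (f p)
    omega
  have key : ∀ p q r : Fin 2 × Bool, (p.1 = q.1 → p.2 = q.2) → (q.1 = r.1 → q.2 = r.2) →
      cancel (f p)⁻¹ (f q) + cancel (f q)⁻¹ (f r) < 2 * norm (f q) := by
    intro p q r hpq hqr
    have hq := hself q
    have l1 : cancel (f p)⁻¹ (f q) ≤ norm (f q) := by
      by_cases h : p.1 = q.1
      · rw [Prod.ext h (hpq h)]; omega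
      · have := norm_mul_eq (f p) (f q)
        have := hle p q h
        omega
    have l2 : cancel (f q)⁻¹ (f r) ≤ norm (f q) := by
      by_cases h : q.1 = r.1
      · rw [← Prod.ext h (hqr h)]; omega
      · have := norm_mul_eq (f q) (f r)
        have := hle' q r h
        omega
    -- At most half of `f q` cancels on either side, so only exact halves on both sides can fail.
    by_contra hcon
    have l1' : cancel (f p)⁻¹ (f q) = norm (f q) := by omega
    have l2' : cancel (f q)⁻¹ (f r) = norm (f q) := by omega
    have h1 : p.1 ≠ q.1 := fun h => by
      rw [Prod.ext h (hpq h)] at l1'; omega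
    have h2 : q.1 ≠ r.1 := fun h => by
      rw [← Prod.ext h (hqr h)] at l2'; omega
    have h3 : p.1 = r.1 := by omega
    by_cases h4 : p.2 = r.2
    · have hpr : p = r := Prod.ext h3 h4
      subst hpr
      have := norm_mul_eq (f p) (f q)
      have := hle' p q h1
      obtain ⟨w, hw⟩ := exists_conj_norm_add_lt (hf1 q) (by omega) l1' l2'
      obtain ⟨d, hd, hd1, hd2⟩ := exists_mem_elementary hs he ht h1 p.2 q.2
      have hmin := hψ _ (D.mul_mem (hc (ψ.symm w⁻¹)) hd)
      rw [size_eq ψ h1, size_eq _ h1, MulAut.mul_apply, MulAut.mul_apply, MulAut.mul_apply,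
        MulAut.mul_apply, hd1, hd2] at hmin
      have c1 : ∀ g, ψ (MulAut.conj (ψ.symm w⁻¹) g) = w⁻¹ * ψ g * w := by
        intro g; simp
      rw [c1, c1, map_mul ψ, ← hf, ← hf] at hmin
      have c2 : norm (w⁻¹ * ψ (of q.1) * w) = norm (w⁻¹ * f q * w) := by
        obtain ⟨j, c⟩ := q
        cases c
        · rw [← norm_inv_eq]; simp [f, mul_assoc]
        · rfl
      rw [c2, ← hfn, ← hfn] at hmin
      omega
    -- Here `f q` and its inverse would share half of their letters with `(f p)⁻¹`.
    · have hpr : f r = (f p)⁻¹ := by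
        rw [hfinv, ← Prod.mk.eta (p := r), ← h3]
        congr 2
        cases h : p.2 <;> cases h' : r.2 <;> simp_all
      rw [hpr] at l2'
      have := min_cancel_le (f q) (f p)⁻¹ (f q)⁻¹
      rw [cancel_comm (f q) (f p)⁻¹, cancel_comm (f p)⁻¹ (f q)⁻¹, cancel_comm (f q) (f q)⁻¹] at this
      omega
  have := length_le_norm_prod (r := fun p q : Fin 2 × Bool => p.1 = q.1 → p.2 = q.2)
    (fun p _ => rfl) key (isReduced_toWord (x := w))
  have hprod : (w.toWord.map f).prod = ψ w := by
    have h1 : ψ.toMonoidHom = lift fun i => ψ (of i) := by ext i; simp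
    have h2 : ψ w = lift (fun i => ψ (of i)) w := by rw [← h1]; rfl
    rw [h2]
    conv_rhs => rw [← mk_toWord (x := w)]
    rw [lift_mk]
  rwa [hprod] at this

theorem eq_letter_of_norm_le_one {w : FreeGroup (Fin 2)} (h1 : w ≠ 1) (h : norm w ≤ 1) :
    ∃ i, ∃ b : Bool, w = cond b (of i) (of i)⁻¹ := by
  have h2 : w.toWord.length = 1 := by
    have : norm w ≠ 0 := by simpa using h1
    have h3 : norm w = w.toWord.length := rfl
    omega
  obtain ⟨⟨i, b⟩, hp⟩ := List.length_eq_one_iff.mp h2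
  refine ⟨i, b, ?_⟩
  rw [← mk_toWord (x := w), hp]
  cases b <;> rfl

/-- **Nielsen's theorem** in rank two: the automorphism group of the free group on two generators is
generated by the elementary automorphisms and the inner ones. -/
theorem eq_top_of_elementary_mem {D : Subgroup (MulAut (FreeGroup (Fin 2)))}
    (hs : swapAut ∈ D) (he : invertAut ∈ D) (ht : transvectAut ∈ D)
    (hc : ∀ g, MulAut.conj g ∈ D) : D = ⊤ := by
  refine eq_top_iff.mpr fun φ _ => ?_
  obtain ⟨d, hd, hmin⟩ := WellFounded.has_min (measure fun d => size (φ * d)).wf (D : Set _)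
    ⟨1, D.one_mem⟩
  have hψ : ∀ d' ∈ D, size (φ * d) ≤ size (φ * d * d') := fun d' hd' => by
    have := hmin (d * d') (D.mul_mem hd hd')
    rw [mul_assoc]
    exact not_lt.mp this
  set ψ := φ * d
  have hletter : ∀ k : Fin 2, ∃ i, ∃ b : Bool, ψ⁻¹ (of k) = cond b (of i) (of i)⁻¹ := by
    intro k
    apply eq_letter_of_norm_le_one
    · simp
    · refine (norm_le_norm_apply_of_minimal hs he ht hc hψ _).trans ?_
      rw [MulAut.apply_inv_self, norm_of]
  obtain ⟨i, b, hi⟩ := hletter 0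
  obtain ⟨j, c, hj⟩ := hletter 1
  have hij : i ≠ j := by
    rintro rfl
    have : ψ⁻¹ (of 0) = ψ⁻¹ (of 1) ∨ ψ⁻¹ (of 0) = ψ⁻¹ (of 1)⁻¹ := by
      rw [map_inv, hi, hj]
      cases b <;> cases c <;> simp
    rcases this with h | h
    · exact absurd ((ψ⁻¹).injective h) (by decide)
    · exact absurd ((ψ⁻¹).injective h) (by decide)
  obtain ⟨d', hd', h0, h1⟩ := exists_mem_signedPerm hs he hij b c
  have : ψ⁻¹ = d' := mulAut_ext fun k => by
    fin_cases k
    · exact hi.trans h0.symm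
    · exact hj.trans h1.symm
  have h3 : φ = d'⁻¹ * d⁻¹ := by
    rw [← this, inv_inv]; simp [ψ]
  rw [h3]
  exact D.mul_mem (D.inv_mem hd') (D.inv_mem hd)

end FreeGroupTwo

/-! ### Commutators in finite quotients of free groups -/

namespace FreeGroup

open Classical in
/-- Left translation by `a` on `Q`, lifted to `Q × ZMod m` by adding `c` when leaving the fibre
over `1`. -/
noncomputable def skewPerm {Q : Type*} [Group Q] (a : Q) {m : ℕ} (c : ZMod m) :
    Equiv.Perm (Q × ZMod m) where
  toFun p := (a * p.1, p.2 + if p.1 = 1 then c else 0)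
  invFun p := (a⁻¹ * p.1, p.2 - if a⁻¹ * p.1 = 1 then c else 0)
  left_inv p := by simp
  right_inv p := by simp

variable {ι : Type*}

open Classical in
/-- The permutation representation over the quotient by `M` in which the generator `l` adds `1` to
the second coordinate on the fibre over `1`, and the other generators fix that coordinate. -/
noncomputable def skewRep (M : Subgroup (FreeGroup ι)) [M.Normal] (l : ι) (m : ℕ) :
    FreeGroup ι →* Equiv.Perm ((FreeGroup ι ⧸ M) × ZMod m) :=
  lift fun i => skewPerm (of i : FreeGroup ι ⧸ M) (if i = l then 1 else 0)

section
variable (M : Subgroup (FreeGroup ι)) [M.Normal] (l : ι) (m : ℕ)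

theorem skewRep_apply_fst (g : FreeGroup ι) (p : (FreeGroup ι ⧸ M) × ZMod m) :
    (skewRep M l m g p).1 = g * p.1 := by
  induction g generalizing p with
  | C1 => simp
  | of i => simp [skewRep, skewPerm]
  | inv_of i h =>
    have := h ((skewRep M l m (of i))⁻¹ p)
    rw [← Equiv.Perm.mul_apply, mul_inv_cancel, Equiv.Perm.one_apply] at this
    rw [_root_.map_inv, this]
    simp
  | mul g h hg hh => simp [hg, hh, mul_assoc]

theorem skewRep_of_self (q : FreeGroup ι ⧸ M) (r : ZMod m) [Decidable (q = 1)] :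
    skewRep M l m (of l) (q, r) = (of l * q, r + if q = 1 then 1 else 0) := by
  simp [skewRep, skewPerm]

theorem skewRep_of_ne {i : ι} (h : i ≠ l) (p : (FreeGroup ι ⧸ M) × ZMod m) :
    skewRep M l m (of i) p = (of i * p.1, p.2) := by
  simp [skewRep, skewPerm, h]

theorem skewRep_of_ne_pow {i : ι} (h : i ≠ l) (n : ℕ) (p : (FreeGroup ι ⧸ M) × ZMod m) :
    skewRep M l m (of i ^ n) p = (of i ^ n * p.1, p.2) := by
  induction n generalizing p with
  | zero => simp
  | succ n ih =>
    rw [pow_succ, _root_.map_mul, Equiv.Perm.mul_apply, skewRep_of_ne M l m h, ih, pow_succ]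
    simp [mul_assoc]

theorem skewRep_pow_of_not_mem {q : FreeGroup ι ⧸ M}
    (hq : q ∉ Subgroup.zpowers (of l : FreeGroup ι ⧸ M)) (r : ZMod m) (n : ℕ) :
    skewRep M l m (of l ^ n) (q, r) = (of l ^ n * q, r) := by
  classical
  induction n with
  | zero => simp
  | succ n ih =>
    have h1 : (of l : FreeGroup ι ⧸ M) ^ n * q ≠ 1 := fun h => hq <| by
      rw [eq_inv_of_mul_eq_one_right h]
      exact inv_mem (Subgroup.npow_mem_zpowers _ _)
    rw [pow_succ', _root_.map_mul, Equiv.Perm.mul_apply, ih, skewRep_of_self, if_neg h1, add_zero,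
      pow_succ', mul_assoc]

theorem skewRep_pow_one (n : ℕ) : ∃ c : ℕ, 1 ≤ c ∧ c ≤ n + 1 ∧
    skewRep M l m (of l ^ (n + 1)) (1, 0) =
      ((of l : FreeGroup ι ⧸ M) ^ (n + 1), (c : ZMod m)) := by
  classical
  induction n with
  | zero =>
    exact ⟨1, le_rfl, le_rfl, by simp [skewRep_of_self]⟩
  | succ n ih =>
    obtain ⟨c, h1, h2, h3⟩ := ih
    refine ⟨c + if (of l : FreeGroup ι ⧸ M) ^ (n + 1) = 1 then 1 else 0, by omega, ?_, ?_⟩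
    · split_ifs <;> omega
    · rw [pow_succ', _root_.map_mul, Equiv.Perm.mul_apply, h3, skewRep_of_self]
      refine Prod.ext (pow_succ' _ _).symm ?_
      split_ifs <;> simp

end

/-- An element which commutes with a power of a generator in a suitable finite quotient lies in the
subgroup of that generator in a given finite quotient. -/
theorem exists_normal_mem_zpowers (M : Subgroup (FreeGroup ι)) [M.Normal] [M.FiniteIndex]
    (l : ι) {k : ℕ} (hk : k ≠ 0) :
    ∃ M' ≤ M, M'.Normal ∧ M'.FiniteIndex ∧
      ∀ g : FreeGroup ι, g * of l ^ k * g⁻¹ * (of l ^ k)⁻¹ ∈ M' →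
        (g : FreeGroup ι ⧸ M) ∈ Subgroup.zpowers (of l : FreeGroup ι ⧸ M) := by
  set N := k * orderOf (of l : FreeGroup ι ⧸ M) with hN
  have hN0 : N ≠ 0 := mul_ne_zero hk (orderOf_pos _).ne'
  have hlN : (of l : FreeGroup ι ⧸ M) ^ N = 1 := by
    rw [hN, mul_comm, pow_mul, pow_orderOf_eq_one, one_pow]
  -- In `skewRep M l (N + 1)` the element `of l ^ N` fixes the fibres outside the cyclic subgroup of
  -- `of l`, and it moves `(1, 0)` because it visits the fibre over `1` between `1` and `N` times.
  refine ⟨(skewRep M l (N + 1)).ker ⊓ M, inf_le_right, inferInstance, inferInstance,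
    fun g hg => ?_⟩
  by_contra hcon
  have h1 : Commute (skewRep M l (N + 1) g) (skewRep M l (N + 1) (of l ^ k)) := by
    have : skewRep M l (N + 1) (g * of l ^ k * g⁻¹ * (of l ^ k)⁻¹) = 1 := hg.1
    rw [_root_.map_mul, _root_.map_mul, _root_.map_mul, _root_.map_inv, _root_.map_inv,
      mul_inv_eq_one, mul_inv_eq_iff_eq_mul] at this
    exact this
  have h2 : Commute (skewRep M l (N + 1) g) (skewRep M l (N + 1) (of l ^ N)) := by
    rw [hN, pow_mul, _root_.map_pow]
    exact h1.pow_right _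
  obtain ⟨n, hn⟩ := Nat.exists_eq_add_one_of_ne_zero hN0
  obtain ⟨c, c1, c2, c3⟩ := skewRep_pow_one M l (N + 1) n
  rw [← hn, hlN] at c3
  have h3 := DFunLike.congr_fun h2.eq ((1 : FreeGroup ι ⧸ M), (0 : ZMod (N + 1)))
  rw [Equiv.Perm.mul_apply, Equiv.Perm.mul_apply, c3] at h3
  have h4 : skewRep M l (N + 1) g (1, 0) =
      ((g : FreeGroup ι ⧸ M), (skewRep M l (N + 1) g (1, 0)).2) :=
    Prod.ext (by simp [skewRep_apply_fst]) rfl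
  rw [h4, skewRep_pow_of_not_mem M l (N + 1) hcon, hlN, one_mul, ← h4] at h3
  have h5 := congrArg Prod.snd ((skewRep M l (N + 1) g).injective h3)
  have h6 : ((c : ZMod (N + 1))) = 0 := h5
  rw [ZMod.natCast_eq_zero_iff] at h6
  have := Nat.le_of_dvd (by omega) h6
  omega

/-- In a suitable finite quotient, the cyclic subgroup of a generator and its conjugate by another
generator have an intersection which is trivial in a given finite quotient. -/
theorem exists_normal_inter_conj (M : Subgroup (FreeGroup ι)) [M.Normal] [M.FiniteIndex]
    {i j : ι} (hij : i ≠ j) :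
    ∃ M' ≤ M, M'.Normal ∧ M'.FiniteIndex ∧ ∀ a b : ℕ,
      (of i ^ a * of j)⁻¹ * (of j * of i ^ b) ∈ M' → of i ^ a ∈ M := by
  classical
  refine ⟨(skewRep M j 2).ker ⊓ M, inf_le_right, inferInstance, inferInstance, fun a b h => ?_⟩
  have h1 : skewRep M j 2 (of i ^ a * of j) = skewRep M j 2 (of j * of i ^ b) := by
    have : skewRep M j 2 ((of i ^ a * of j)⁻¹ * (of j * of i ^ b)) = 1 := h.1
    rwa [_root_.map_mul, _root_.map_inv, inv_mul_eq_one] at this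
  have h2 := DFunLike.congr_fun h1 ((1 : FreeGroup ι ⧸ M), (0 : ZMod 2))
  rw [_root_.map_mul, _root_.map_mul, Equiv.Perm.mul_apply, Equiv.Perm.mul_apply, skewRep_of_self,
    skewRep_of_ne_pow M j 2 hij, skewRep_of_ne_pow M j 2 hij, skewRep_of_self] at h2
  have h3 : (of i : FreeGroup ι ⧸ M) ^ b = 1 := by
    have := congrArg Prod.snd h2
    by_contra hne
    simp [hne] at this
  have h4 := congrArg Prod.fst h2
  simp [h3] at h4
  rw [← QuotientGroup.eq_one_iff]
  exact h4

/-- An element which in a suitable finite quotient commutes with a power of a generator and with a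
conjugate of that power by another generator is trivial in a given finite quotient. -/
theorem exists_normal_commute_imp_mem (M : Subgroup (FreeGroup ι)) [M.Normal] [M.FiniteIndex]
    {i j : ι} (hij : i ≠ j) {k : ℕ} (hk : k ≠ 0) :
    ∃ M' ≤ M, M'.Normal ∧ M'.FiniteIndex ∧ ∀ g : FreeGroup ι,
      g * of i ^ k * g⁻¹ * (of i ^ k)⁻¹ ∈ M' →
      g * (of j * of i ^ k * (of j)⁻¹) * g⁻¹ * (of j * of i ^ k * (of j)⁻¹)⁻¹ ∈ M' → g ∈ M := by
  obtain ⟨M₁, hM₁, _, _, h₁⟩ := exists_normal_inter_conj M hij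
  obtain ⟨M₂, hM₂, hn, _, h₂⟩ := exists_normal_mem_zpowers M₁ i hk
  refine ⟨M₂, hM₂.trans hM₁, inferInstance, inferInstance, fun g hg hg' => ?_⟩
  classical
  have hpow : ∀ g : FreeGroup ι,
      (g : FreeGroup ι ⧸ M₁) ∈ Subgroup.zpowers (of i : FreeGroup ι ⧸ M₁) →
      ∃ a : ℕ, (of i ^ a)⁻¹ * g ∈ M₁ := fun g hg => by
    obtain ⟨a, ha⟩ := (mem_zpowers_iff_mem_range_orderOf.trans Finset.mem_image).mp hg
    exact ⟨a, QuotientGroup.eq.mp ha.2⟩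
  obtain ⟨a, ha⟩ := hpow g (h₂ g hg)
  obtain ⟨b, hb⟩ := hpow ((of j)⁻¹ * g * of j) (h₂ _ (by
    have := hn.conj_mem _ hg' (of j)⁻¹
    simpa [mul_assoc] using this))
  have h3 : of i ^ a ∈ M := h₁ a b (by
    rw [← QuotientGroup.eq] at ha hb ⊢
    simp only [QuotientGroup.mk_mul, QuotientGroup.mk_inv] at ha hb ⊢
    rw [ha, hb]
    group)
  exact (Subgroup.mul_mem_cancel_left _ (M.inv_mem h3)).mp (hM₁ ha)

/-- A free group of rank at least two has trivial centre. -/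
theorem eq_one_of_forall_commute_of {ι : Type*} [DecidableEq ι] [Nontrivial ι] {g : FreeGroup ι}
    (h : ∀ j, Commute g (of j)) : g = 1 := by
  by_contra hg
  obtain ⟨p, l, hp⟩ := List.exists_cons_of_ne_nil (mt toWord_eq_nil_iff.mp hg)
  obtain ⟨j, hj⟩ := exists_ne p.1
  have h1 : (of j * g).toWord = (j, true) :: g.toWord := by
    rw [toWord_mul, toWord_of, List.singleton_append]
    apply IsReduced.reduce_eq
    have := isReduced_toWord (x := g)
    rw [hp] at this ⊢
    exact List.isChain_cons_cons.mpr ⟨fun h => absurd h hj, this⟩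
  have h2 := toWord_mul_sublist g (of j)
  rw [(h j).eq, h1, toWord_of] at h2
  have h3 := h2.eq_of_length (by simp)
  rw [hp] at h3
  exact hj (congrArg Prod.fst (List.cons.inj h3).1)

end FreeGroup

/-! ### The two-step extension acting on the free group -/

namespace FreeGroupTwo

open FreeGroup hiding map_mul map_inv map_one

/-- The hyperelliptic involution `x ↦ x⁻¹`, `y ↦ y⁻¹`. With it the free group generates
`ℤ/2 * ℤ/2 * ℤ/2 = ⟨a, b, c⟩`, where `x = a * b`, `y = b * c` and `b` is the involution. -/
def negAut : MulAut (FreeGroup (Fin 2)) :=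
  autOfImages ![(of 0)⁻¹, (of 1)⁻¹] ![(of 0)⁻¹, (of 1)⁻¹] (by decide) (by decide)

/-- Conjugation by `a * b * c`, a loop around the first puncture of the sphere. -/
def punctureP : MulAut (FreeGroup (Fin 2)) := MulAut.conj (of 0 * (of 1)⁻¹) * negAut

/-- Conjugation by `b * c * a`, a loop around the second puncture. -/
def punctureU : MulAut (FreeGroup (Fin 2)) := MulAut.conj (of 1 * of 0) * negAut

/-- Conjugation by `c * a * b`, a loop around the third puncture. -/
def punctureV : MulAut (FreeGroup (Fin 2)) := MulAut.conj ((of 1)⁻¹ * (of 0)⁻¹) * negAut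

/-- The automorphism `x ↦ x`, `y ↦ x ^ 2 * y`, the square of a Dehn twist of the torus. -/
def dehnA : MulAut (FreeGroup (Fin 2)) :=
  autOfImages ![of 0, of 0 ^ 2 * of 1] ![of 0, (of 0 ^ 2)⁻¹ * of 1] (by decide) (by decide)

/-- The automorphism `x ↦ x * y⁻²`, `y ↦ y`, the square of a Dehn twist of the torus. -/
def dehnB : MulAut (FreeGroup (Fin 2)) :=
  autOfImages ![of 0 * (of 1 ^ 2)⁻¹, of 1] ![of 0 * of 1 ^ 2, of 1] (by decide) (by decide)

/-- The action of the pushes of the first puncture around the base point, around the third puncture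
and around the second puncture. -/
def fiberHom : FreeGroup (Fin 3) →* MulAut (FreeGroup (Fin 2)) :=
  lift ![punctureP, punctureV⁻¹ * dehnA, punctureU⁻¹ * dehnB]

/-- The action of the pushes of the base point around the second and the third puncture. -/
def baseHom : FreeGroup (Fin 2) →* MulAut (FreeGroup (Fin 2)) := lift ![punctureU, punctureV]

/-- The action of conjugation by the first generator of the base on the fibre. -/
def actU : MulAut (FreeGroup (Fin 3)) :=
  autOfImages ![(of 2)⁻¹ * of 0 * of 2, of 1 * (of 0)⁻¹ * (of 2)⁻¹ * of 0 * of 2, of 2]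
    ![of 2 * of 0 * (of 2)⁻¹, of 1 * (of 0)⁻¹ * of 2 * of 0 * (of 2)⁻¹, of 2]
    (by decide) (by decide)

/-- The action of conjugation by the second generator of the base on the fibre. -/
def actV : MulAut (FreeGroup (Fin 3)) :=
  autOfImages ![(of 1)⁻¹ * of 0 * of 1, of 1, (of 1)⁻¹ * of 0 * of 1 * (of 0)⁻¹ * of 2]
    ![of 1 * of 0 * (of 1)⁻¹, of 1, of 1 * of 0 * (of 1)⁻¹ * (of 0)⁻¹ * of 2]
    (by decide) (by decide)

/-- The action of the base on the fibre. -/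
def monodromy : FreeGroup (Fin 2) →* MulAut (FreeGroup (Fin 3)) := lift ![actU, actV]

theorem fiberHom_monodromy (g : FreeGroup (Fin 2)) :
    fiberHom.comp (monodromy g).toMonoidHom =
      (MulAut.conj (baseHom g)).toMonoidHom.comp fiberHom := by
  have key : ∀ i j, fiberHom (monodromy (of i) (of j)) * baseHom (of i) =
      baseHom (of i) * fiberHom (of j) := fun i j => by
    refine mulAut_ext ?_
    revert i j
    decide +kernel
  have hgen : ∀ i, fiberHom.comp (monodromy (of i)).toMonoidHom =
      (MulAut.conj (baseHom (of i))).toMonoidHom.comp fiberHom := fun i => by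
    ext1 j
    exact eq_mul_inv_of_mul_eq (key i j)
  suffices H : ∀ n, fiberHom (monodromy g n) = baseHom g * fiberHom n * (baseHom g)⁻¹ from
    MonoidHom.ext H
  induction g with
  | C1 => simp
  | of i => exact DFunLike.congr_fun (hgen i)
  | inv_of i h =>
    intro n
    have := h ((monodromy (of i))⁻¹ n)
    rw [MulAut.apply_inv_self] at this
    rw [map_inv, map_inv, this]
    group
  | mul g h hg hh =>
    intro n
    rw [map_mul, MulAut.mul_apply, hg, hh, map_mul]
    group

/-- The pure mapping class group of the sphere with five punctures, in its structure of a
free-by-free group given by forgetting the first puncture. The base is generated by pushes of the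
base point around the second and the third puncture, see `fiberHom` for the fibre. -/
abbrev BraidExt : Type := FreeGroup (Fin 3) ⋊[monodromy] FreeGroup (Fin 2)

open SemidirectProduct (inl inr rightHom)

/-- The action of the extension on the free group. -/
def braidHom : BraidExt →* MulAut (FreeGroup (Fin 2)) :=
  SemidirectProduct.lift fiberHom baseHom fiberHom_monodromy

/-- The loops of the base point around three punctures, as elements of the extension. -/
def punctureHom : FreeGroup (Fin 3) →* BraidExt :=
  lift ![inl (of 0), inr (of 0), inr (of 1)]

/-- The automorphisms of the free group given by the loops around three punctures. -/
def punctureAut : FreeGroup (Fin 3) →* MulAut (FreeGroup (Fin 2)) :=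
  lift ![punctureP, punctureU, punctureV]

theorem braidHom_comp_punctureHom : braidHom.comp punctureHom = punctureAut := by
  ext1 i
  fin_cases i <;> simp [braidHom, punctureHom, punctureAut, fiberHom, baseHom]

theorem _root_.Subgroup.mem_normalizer_closure {G : Type*} [Group G] {S : Set G} {g : G}
    (h : ∀ s ∈ S, g * s * g⁻¹ ∈ Subgroup.closure S)
    (h' : ∀ s ∈ S, g⁻¹ * s * g ∈ Subgroup.closure S) :
    g ∈ Subgroup.normalizer (Subgroup.closure S : Set G) := by
  rw [Subgroup.mem_normalizer_iff]
  have h1 : Subgroup.closure S ≤ (Subgroup.closure S).comap (MulAut.conj g).toMonoidHom :=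
    (Subgroup.closure_le _).mpr h
  have h2 : Subgroup.closure S ≤ (Subgroup.closure S).comap (MulAut.conj g⁻¹).toMonoidHom :=
    (Subgroup.closure_le _).mpr fun s hs => by simpa using h' s hs
  refine fun n => ⟨fun hn => h1 hn, fun hn => ?_⟩
  have := h2 hn
  simpa [mul_assoc] using this

theorem closure_braidExt_generators : Subgroup.closure
    ({inl (of 0), inl (of 1), inl (of 2), inr (of 0), inr (of 1)} : Set BraidExt) = ⊤ := by
  set D := Subgroup.closure
    ({inl (of 0), inl (of 1), inl (of 2), inr (of 0), inr (of 1)} : Set BraidExt)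
  have hl : ∀ n : FreeGroup (Fin 3), (inl n : BraidExt) ∈ D := fun n => by
    have : (⊤ : Subgroup (FreeGroup (Fin 3))) ≤ D.comap inl := by
      rw [← closure_range_of, Subgroup.closure_le]
      rintro _ ⟨i, rfl⟩
      refine Subgroup.subset_closure ?_
      fin_cases i <;> simp
    exact this (Subgroup.mem_top n)
  have hr : ∀ f : FreeGroup (Fin 2), (inr f : BraidExt) ∈ D := fun f => by
    have : (⊤ : Subgroup (FreeGroup (Fin 2))) ≤ D.comap inr := by
      rw [← closure_range_of, Subgroup.closure_le]
      rintro _ ⟨i, rfl⟩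
      refine Subgroup.subset_closure ?_
      fin_cases i <;> simp
    exact this (Subgroup.mem_top f)
  refine eq_top_iff.mpr fun e _ => ?_
  rw [← SemidirectProduct.inl_left_mul_inr_right e]
  exact D.mul_mem (hl _) (hr _)

theorem range_punctureHom : punctureHom.range =
    Subgroup.closure {inl (of 0), inr (of 0), inr (of 1)} := by
  rw [punctureHom, range_lift_eq_closure]
  congr 1
  ext e
  simp [eq_comm (a := e)]
  tauto

/-- The point pushes of the base point form a normal subgroup, the kernel of forgetting the base
point. -/
instance : punctureHom.range.Normal := by
  rw [← Subgroup.normalizer_eq_top_iff, eq_top_iff, ← closure_braidExt_generators,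
    Subgroup.closure_le, range_punctureHom]
  set t : BraidExt := inl (of 0) with ht
  set a : BraidExt := inl (of 1) with ha
  set b : BraidExt := inl (of 2) with hb
  set u : BraidExt := inr (of 0) with hu
  set v : BraidExt := inr (of 1) with hv
  have relU : ∀ n, u * inl n * u⁻¹ = inl (actU n) := fun n => by
    rw [hu, ← map_inv, ← SemidirectProduct.inl_aut]; simp [monodromy]
  have relV : ∀ n, v * inl n * v⁻¹ = inl (actV n) := fun n => by
    rw [hv, ← map_inv, ← SemidirectProduct.inl_aut]; simp [monodromy]
  have ut : u * t * u⁻¹ = b⁻¹ * t * b := by rw [ht, relU]; simp [actU, hb]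
  have ua : u * a * u⁻¹ = a * t⁻¹ * b⁻¹ * t * b := by rw [ha, relU]; simp [actU, ht, hb]
  have ub : u * b * u⁻¹ = b := by rw [hb, relU]; simp [actU]
  have vt : v * t * v⁻¹ = a⁻¹ * t * a := by rw [ht, relV]; simp [actV, ha]
  have va : v * a * v⁻¹ = a := by rw [ha, relV]; simp [actV]
  have vb : v * b * v⁻¹ = a⁻¹ * t * a * t⁻¹ * b := by rw [hb, relV]; simp [actV, ht, ha]
  set N := Subgroup.closure {t, u, v}
  have htN : t ∈ N := Subgroup.subset_closure (by simp)
  have huN : u ∈ N := Subgroup.subset_closure (by simp)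
  have hvN : v ∈ N := Subgroup.subset_closure (by simp)
  have htN' : b⁻¹ * t * b ∈ N := ut ▸ N.mul_mem (N.mul_mem huN htN) (N.inv_mem huN)
  have htN'' : a⁻¹ * t * a ∈ N := vt ▸ N.mul_mem (N.mul_mem hvN htN) (N.inv_mem hvN)
  have at' : a * t * a⁻¹ = v⁻¹ * t * v := by
    calc a * t * a⁻¹ = v⁻¹ * (v * a * v⁻¹) * (v * t * v⁻¹) * (v * a * v⁻¹)⁻¹ * v := by group
      _ = v⁻¹ * t * v := by rw [va, vt]; group
  have bt' : b * t * b⁻¹ = u⁻¹ * t * u := by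
    calc b * t * b⁻¹ = u⁻¹ * (u * b * u⁻¹) * (u * t * u⁻¹) * (u * b * u⁻¹)⁻¹ * u := by group
      _ = u⁻¹ * t * u := by rw [ub, ut]; group
  have atN : a * t * a⁻¹ ∈ N := at' ▸ N.mul_mem (N.mul_mem (N.inv_mem hvN) htN) hvN
  have btN : b * t * b⁻¹ ∈ N := bt' ▸ N.mul_mem (N.mul_mem (N.inv_mem huN) htN) huN
  have au : a⁻¹ * u * a = t⁻¹ * u * t := by
    calc a⁻¹ * u * a = a⁻¹ * (u * a * u⁻¹) * u := by group
      _ = t⁻¹ * (b⁻¹ * t * b) * u := by rw [ua]; group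
      _ = t⁻¹ * u * t := by rw [← ut]; group
  have au' : a * u * a⁻¹ = (a * t * a⁻¹) * u * (a * t * a⁻¹)⁻¹ := by
    calc a * u * a⁻¹ = (a * t * a⁻¹) * (a * (t⁻¹ * u * t) * a⁻¹) * (a * t * a⁻¹)⁻¹ := by group
      _ = (a * t * a⁻¹) * u * (a * t * a⁻¹)⁻¹ := by rw [← au]; group
  have bv : b * v * b⁻¹ = t * v * t⁻¹ := by
    calc b * v * b⁻¹ = (v⁻¹ * (v * b * v⁻¹) * b⁻¹)⁻¹ := by group
      _ = (v⁻¹ * (a⁻¹ * t * a) * t⁻¹)⁻¹ := by rw [vb]; group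
      _ = t * v * t⁻¹ := by rw [← vt]; group
  have bv' : b⁻¹ * v * b = (b⁻¹ * t * b)⁻¹ * v * (b⁻¹ * t * b) := by
    calc b⁻¹ * v * b = (b⁻¹ * t * b)⁻¹ * (b⁻¹ * (t * v * t⁻¹) * b) * (b⁻¹ * t * b) := by group
      _ = (b⁻¹ * t * b)⁻¹ * v * (b⁻¹ * t * b) := by rw [← bv]; group
  have haN : a ∈ Subgroup.normalizer (N : Set BraidExt) := by
    refine Subgroup.mem_normalizer_closure ?_ ?_
    · rintro s (rfl | rfl | rfl)
      · exact atN
      · rw [au']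
        exact N.mul_mem (N.mul_mem atN huN) (N.inv_mem atN)
      · rwa [← mul_inv_eq_iff_eq_mul.mp va, mul_inv_cancel_right]
    · rintro s (rfl | rfl | rfl)
      · exact htN''
      · rw [au]
        exact N.mul_mem (N.mul_mem (N.inv_mem htN) huN) htN
      · rwa [mul_assoc, mul_inv_eq_iff_eq_mul.mp va, inv_mul_cancel_left]
  have hbN : b ∈ Subgroup.normalizer (N : Set BraidExt) := by
    refine Subgroup.mem_normalizer_closure ?_ ?_
    · rintro s (rfl | rfl | rfl)
      · exact btN
      · rwa [← mul_inv_eq_iff_eq_mul.mp ub, mul_inv_cancel_right]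
      · rw [bv]
        exact N.mul_mem (N.mul_mem htN hvN) (N.inv_mem htN)
    · rintro s (rfl | rfl | rfl)
      · exact htN'
      · rwa [mul_assoc, mul_inv_eq_iff_eq_mul.mp ub, inv_mul_cancel_left]
      · rw [bv']
        exact N.mul_mem (N.mul_mem (N.inv_mem htN') hvN) htN'
  have hN := Subgroup.le_normalizer (H := N)
  rintro e (rfl | rfl | rfl | rfl | rfl)
  exacts [hN htN, haN, hbN, hN huN, hN hvN]

/-! ### Loops around the punctures as inner automorphisms -/


/-- The permutation of `G × κ` which permutes the second coordinate by an involution `τ` and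
multiplies the first coordinate by weights `w`, chosen so that it is an involution. -/
def monomialPerm {G κ : Type*} [Group G] (τ : κ → κ) (w : κ → G) (hτ : ∀ i, τ (τ i) = i)
    (hw : ∀ i, w (τ i) * w i = 1) : Equiv.Perm (G × κ) where
  toFun p := (w p.2 * p.1, τ p.2)
  invFun p := (w p.2 * p.1, τ p.2)
  left_inv p := by simp [hτ, ← mul_assoc, hw]
  right_inv p := by simp [hτ, ← mul_assoc, hw]

/-- The generator `a` of `ℤ/2 * ℤ/2 * ℤ/2` acting by left translation on that group, written as the
union of the cosets represented by `1`, `a`, `b`, `c` of the free subgroup on `a * b * c`,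
`b * c * a`, `c * a * b`. -/
def reflA : Equiv.Perm (FreeGroup (Fin 3) × Fin 4) :=
  monomialPerm ![1, 0, 3, 2] ![1, 1, of 2, (of 2)⁻¹] (by decide) (by decide)

/-- The generator `b` acting as in `reflA`. -/
def reflB : Equiv.Perm (FreeGroup (Fin 3) × Fin 4) :=
  monomialPerm ![2, 3, 0, 1] ![1, (of 0)⁻¹, 1, of 0] (by decide) (by decide)

/-- The generator `c` acting as in `reflA`. -/
def reflC : Equiv.Perm (FreeGroup (Fin 3) × Fin 4) :=
  monomialPerm ![3, 2, 1, 0] ![1, of 1, (of 1)⁻¹, 1] (by decide) (by decide)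

theorem monomialPerm_mul_self {G κ : Type*} [Group G] (τ : κ → κ) (w : κ → G) (hτ hw) :
    monomialPerm τ w hτ hw * monomialPerm τ w hτ hw = 1 := by
  ext p : 1
  exact (monomialPerm τ w hτ hw).left_inv p

/-- The free group on `x = a * b`, `y = b * c` acting as in `reflA`. -/
def cosetPerm : FreeGroup (Fin 2) →* Equiv.Perm (FreeGroup (Fin 3) × Fin 4) :=
  lift ![reflA * reflB, reflB * reflC]

theorem cosetPerm_negAut (g : FreeGroup (Fin 2)) :
    cosetPerm (negAut g) = reflB * cosetPerm g * reflB := by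
  have ha : reflA * reflA = 1 := monomialPerm_mul_self ..
  have hb : reflB * reflB = 1 := monomialPerm_mul_self ..
  have hc : reflC * reflC = 1 := monomialPerm_mul_self ..
  have ha' := inv_eq_of_mul_eq_one_left ha
  have hb' := inv_eq_of_mul_eq_one_left hb
  have hc' := inv_eq_of_mul_eq_one_left hc
  have : cosetPerm.comp negAut.toMonoidHom = (MulAut.conj reflB).toMonoidHom.comp cosetPerm := by
    ext1 i
    fin_cases i
    · simp [negAut, cosetPerm, ha', hb', mul_assoc, hb]
    · simp [negAut, cosetPerm, hc', hb', ← mul_assoc, hb]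
  have := DFunLike.congr_fun this g
  simpa [hb'] using this

theorem cosetPerm_negAut_pow (k : ℕ) (g : FreeGroup (Fin 2)) :
    cosetPerm ((negAut ^ k) g) * reflB ^ k = reflB ^ k * cosetPerm g := by
  have hb : reflB * reflB = 1 := monomialPerm_mul_self ..
  induction k with
  | zero => simp
  | succ k ih =>
    rw [pow_succ', MulAut.mul_apply, cosetPerm_negAut, pow_succ' reflB, mul_assoc _ reflB,
      ← mul_assoc reflB reflB, hb, one_mul, mul_assoc, ih, mul_assoc]

/-- The word `w` in the loops around the punctures can be recovered from the corresponding element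
of `ℤ/2 * ℤ/2 * ℤ/2`, as the image of `(1, 0)`. -/
theorem exists_conj_mul_negAut_pow (w : FreeGroup (Fin 3)) : ∃ (g : FreeGroup (Fin 2)) (k : ℕ),
    punctureAut w = MulAut.conj g * negAut ^ k ∧
    ∀ f, (cosetPerm g * reflB ^ k) (f, 0) = (w * f, 0) := by
  induction w with
  | C1 => exact ⟨1, 0, by simp, by simp⟩
  | of i =>
    fin_cases i
    · exact ⟨of 0 * (of 1)⁻¹, 1, by simp [punctureAut, punctureP], fun f => by
        simp [cosetPerm, reflA, reflB, reflC, monomialPerm]⟩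
    · exact ⟨of 1 * of 0, 1, by simp [punctureAut, punctureU], fun f => by
        simp [cosetPerm, reflA, reflB, reflC, monomialPerm]⟩
    · exact ⟨(of 1)⁻¹ * (of 0)⁻¹, 1, by simp [punctureAut, punctureV], fun f => by
        simp [cosetPerm, reflA, reflB, reflC, monomialPerm]⟩
  | inv_of i _ =>
    rw [map_inv]
    fin_cases i
    · exact ⟨(of 1)⁻¹ * of 0, 1, mulAut_ext (by decide +kernel), fun f => by
        simp [cosetPerm, reflA, reflB, reflC, monomialPerm]⟩
    · exact ⟨of 0 * of 1, 1, mulAut_ext (by decide +kernel), fun f => by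
        simp [cosetPerm, reflA, reflB, reflC, monomialPerm]⟩
    · exact ⟨(of 0)⁻¹ * (of 1)⁻¹, 1, mulAut_ext (by decide +kernel), fun f => by
        simp [cosetPerm, reflA, reflB, reflC, monomialPerm]⟩
  | mul g h hg hh =>
    obtain ⟨g₁, k₁, h₁, h₁'⟩ := hg
    obtain ⟨g₂, k₂, h₂, h₂'⟩ := hh
    refine ⟨g₁ * (negAut ^ k₁) g₂, k₁ + k₂, ?_, fun f => ?_⟩
    · rw [map_mul, h₁, h₂]
      ext z
      simp [pow_add, mul_assoc]
    · rw [map_mul, pow_add, mul_assoc, ← mul_assoc _ (reflB ^ k₁), cosetPerm_negAut_pow,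
        mul_assoc (reflB ^ k₁), ← mul_assoc, Equiv.Perm.mul_apply, h₂', h₁', mul_assoc]

theorem conj_eq_one_iff (g : FreeGroup (Fin 2)) : MulAut.conj g = 1 ↔ g = 1 := by
  refine ⟨fun h => eq_one_of_forall_commute_of fun j => ?_, fun h => by simp [h]⟩
  have := DFunLike.congr_fun h (of j)
  rw [MulAut.conj_apply, MulAut.one_apply, mul_inv_eq_iff_eq_mul] at this
  exact this

/-- The loops around three punctures are free generators of a group of automorphisms. -/
theorem punctureAut_injective : Function.Injective punctureAut := by
  refine (injective_iff_map_eq_one _).mpr fun w hw => ?_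
  obtain ⟨g, k, h1, h2⟩ := exists_conj_mul_negAut_pow w
  rw [hw] at h1
  have hneg : negAut * negAut = 1 := mulAut_ext (by decide)
  have hb : reflB * reflB = 1 := monomialPerm_mul_self ..
  -- For odd `k` the automorphism acts by `-1` on the abelianization.
  rcases Nat.even_or_odd' k with ⟨m, rfl | rfl⟩
  · rw [pow_mul, pow_two, hneg, one_pow, mul_one] at h1
    have h3 := h2 1
    rw [(conj_eq_one_iff g).mp h1.symm, pow_mul, pow_two, hb] at h3
    simpa using (congrArg Prod.fst h3).symm
  · exfalso
    rw [pow_succ, pow_mul, pow_two, hneg, one_pow, one_mul] at h1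
    have h3 := congrArg
      (lift fun i : Fin 2 => Multiplicative.ofAdd (if i = 0 then (1 : ℤ) else 0))
      (DFunLike.congr_fun h1 (of 0))
    have h4 := congrArg Multiplicative.toAdd h3
    simp [negAut] at h4

/-- Up to four cosets, inner automorphisms are products of loops around the punctures. -/
theorem exists_conj_eq_punctureAut_mul_conj (w : FreeGroup (Fin 2)) :
    ∃ τ ∈ ({1, of 0, of 1, of 0 * of 1} : Set (FreeGroup (Fin 2))), ∃ n : FreeGroup (Fin 3),
    MulAut.conj w = punctureAut n * MulAut.conj τ := by
  set T : Set (FreeGroup (Fin 2)) := {1, of 0, of 1, of 0 * of 1} with hT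
  set K := punctureAut.range.comap MulAut.conj
  -- Schreier generators of the kernel of the reduction of the free group to `(ℤ/2)²`.
  have h1 : ∀ g ∈ ({1, of 0 * of 0, of 1 * of 1, of 1 * of 0 * (of 1)⁻¹ * (of 0)⁻¹,
      of 0 * of 1 * of 0 * (of 1)⁻¹, of 0 * of 1 * of 1 * (of 0)⁻¹} : Set (FreeGroup (Fin 2))),
      g ∈ K := by
    rintro g (rfl | rfl | rfl | rfl | rfl | rfl)
    · exact K.one_mem
    · exact ⟨of 0 * of 2, mulAut_ext (by decide +kernel)⟩
    · exact ⟨of 1 * of 0, mulAut_ext (by decide +kernel)⟩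
    · exact ⟨of 1 ^ 2, mulAut_ext (by decide +kernel)⟩
    · exact ⟨(of 1)⁻¹ * (of 2)⁻¹ * (of 0)⁻¹ * (of 1)⁻¹, mulAut_ext (by decide +kernel)⟩
    · exact ⟨(of 1)⁻¹ * (of 0)⁻¹, mulAut_ext (by decide +kernel)⟩
  have h2 : ∀ j, ∀ τ ∈ T, ∃ τ' ∈ T, τ * of j * τ'⁻¹ ∈ K ∧ τ' * of j * τ⁻¹ ∈ K := by
    intro j
    fin_cases j
    · rintro τ (rfl | rfl | rfl | rfl)
      · exact ⟨of 0, by simp [hT], h1 _ (by simp), h1 _ (by simp)⟩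
      · exact ⟨1, by simp [hT], h1 _ (by simp), h1 _ (by simp)⟩
      · exact ⟨of 0 * of 1, by simp [hT], h1 _ (by simp [mul_assoc]), h1 _ (by simp)⟩
      · exact ⟨of 1, by simp [hT], h1 _ (by simp), h1 _ (by simp [mul_assoc])⟩
    · rintro τ (rfl | rfl | rfl | rfl)
      · exact ⟨of 1, by simp [hT], h1 _ (by simp), h1 _ (by simp)⟩
      · exact ⟨of 0 * of 1, by simp [hT], h1 _ (by simp), h1 _ (by simp)⟩
      · exact ⟨1, by simp [hT], h1 _ (by simp), h1 _ (by simp)⟩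
      · exact ⟨of 0, by simp [hT], h1 _ (by simp), h1 _ (by simp)⟩
  have h3 : ∀ w, ∀ τ ∈ T, ∃ τ' ∈ T, τ * w * τ'⁻¹ ∈ K := by
    intro w
    induction w with
    | C1 => exact fun τ hτ => ⟨τ, hτ, by simp⟩
    | of j => exact fun τ hτ => (h2 j τ hτ).imp fun τ' h => ⟨h.1, h.2.1⟩
    | inv_of j _ =>
      intro τ hτ
      obtain ⟨τ', h, -, h'⟩ := h2 j τ hτ
      exact ⟨τ', h, by simpa [mul_assoc] using K.inv_mem h'⟩
    | mul g h hg hh =>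
      intro τ hτ
      obtain ⟨τ₁, h₁, h₁'⟩ := hg τ hτ
      obtain ⟨τ₂, h₂, h₂'⟩ := hh τ₁ h₁
      exact ⟨τ₂, h₂, by simpa [mul_assoc] using K.mul_mem h₁' h₂'⟩
  obtain ⟨τ, hτ, n, hn⟩ := h3 w 1 (by simp [hT])
  refine ⟨τ, hτ, n, ?_⟩
  rw [hn, ← map_mul]
  simp

/-! ### The level two subgroup -/


theorem _root_.Subgroup.mem_normalizer_closure_of_mul_self_mem {G : Type*} [Group G]
    {S : Set G} {g : G}
    (h : ∀ s ∈ S, g * s * g⁻¹ ∈ Subgroup.closure S) (hg : g * g ∈ Subgroup.closure S) :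
    g ∈ Subgroup.normalizer (Subgroup.closure S : Set G) := by
  refine Subgroup.mem_normalizer_closure h fun s hs => ?_
  have h1 : Subgroup.closure S ≤ (Subgroup.closure S).comap (MulAut.conj g).toMonoidHom :=
    (Subgroup.closure_le _).mpr h
  have h2 := h1 (mul_mem (mul_mem (inv_mem hg) (Subgroup.subset_closure hs)) hg)
  simpa [mul_assoc] using h2

/-- The subgroup generated by the squares of two Dehn twists, the hyperelliptic involution and the
inner automorphisms. It is the group `levelTwoDetOne` of automorphisms which have determinant `1`
and are trivial modulo `2` on the abelianization. -/
def levelTwo : Subgroup (MulAut (FreeGroup (Fin 2))) :=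
  Subgroup.closure ({dehnA, dehnB, negAut} ∪ Set.range MulAut.conj)

theorem dehnA_mem : dehnA ∈ levelTwo := Subgroup.subset_closure (by simp)
theorem dehnB_mem : dehnB ∈ levelTwo := Subgroup.subset_closure (by simp)
theorem negAut_mem : negAut ∈ levelTwo := Subgroup.subset_closure (by simp)
theorem conj_mem (g : FreeGroup (Fin 2)) : MulAut.conj g ∈ levelTwo :=
  Subgroup.subset_closure (by simp)

theorem mul_conj_mul_inv (φ : MulAut (FreeGroup (Fin 2))) (g : FreeGroup (Fin 2)) :
    φ * MulAut.conj g * φ⁻¹ = MulAut.conj (φ g) := by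
  ext z; simp

theorem mem_normalizer_levelTwo {φ : MulAut (FreeGroup (Fin 2))}
    (hA : φ * dehnA * φ⁻¹ ∈ levelTwo) (hB : φ * dehnB * φ⁻¹ ∈ levelTwo)
    (hn : φ * negAut * φ⁻¹ ∈ levelTwo) (hφ : φ * φ ∈ levelTwo) :
    φ ∈ Subgroup.normalizer (levelTwo : Set (MulAut (FreeGroup (Fin 2)))) := by
  refine Subgroup.mem_normalizer_closure_of_mul_self_mem ?_ hφ
  rintro s ((rfl | rfl | rfl) | ⟨g, rfl⟩)
  exacts [hA, hB, hn, mul_conj_mul_inv φ g ▸ conj_mem _]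

theorem swapAut_mul_self : swapAut * swapAut = 1 := mulAut_ext (by decide +kernel)
theorem invertAut_mul_self : invertAut * invertAut = 1 := mulAut_ext (by decide +kernel)
theorem transvectAut_mul_self : transvectAut * transvectAut = dehnB⁻¹ :=
  mulAut_ext (by decide +kernel)

instance : levelTwo.Normal := by
  rw [← Subgroup.normalizer_eq_top_iff]
  have iA := levelTwo.inv_mem dehnA_mem
  have iB := levelTwo.inv_mem dehnB_mem
  refine eq_top_of_elementary_mem ?_ ?_ ?_ fun g => Subgroup.le_normalizer (conj_mem g)
  · refine mem_normalizer_levelTwo ?_ ?_ ?_ (swapAut_mul_self ▸ levelTwo.one_mem)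
    · rw [show swapAut * dehnA * swapAut⁻¹ = MulAut.conj (of 1 ^ 2) * dehnB⁻¹ from
        mulAut_ext (by decide +kernel)]
      exact levelTwo.mul_mem (conj_mem _) iB
    · rw [show swapAut * dehnB * swapAut⁻¹ = MulAut.conj (of 0 ^ 2) * dehnA⁻¹ from
        mulAut_ext (by decide +kernel)]
      exact levelTwo.mul_mem (conj_mem _) iA
    · rw [show swapAut * negAut * swapAut⁻¹ = negAut from mulAut_ext (by decide +kernel)]
      exact negAut_mem
  · refine mem_normalizer_levelTwo ?_ ?_ ?_ (invertAut_mul_self ▸ levelTwo.one_mem)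
    · rw [show invertAut * dehnA * invertAut⁻¹ = dehnA⁻¹ from mulAut_ext (by decide +kernel)]
      exact iA
    · rw [show invertAut * dehnB * invertAut⁻¹ = MulAut.conj (of 1 ^ 2) * dehnB⁻¹ from
        mulAut_ext (by decide +kernel)]
      exact levelTwo.mul_mem (conj_mem _) iB
    · rw [show invertAut * negAut * invertAut⁻¹ = negAut from mulAut_ext (by decide +kernel)]
      exact negAut_mem
  · refine mem_normalizer_levelTwo ?_ ?_ ?_ (transvectAut_mul_self ▸ iB)
    · rw [show transvectAut * dehnA * transvectAut⁻¹ =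
        MulAut.conj (of 0 * (of 1)⁻¹) * negAut * dehnB⁻¹ * dehnA⁻¹ from
        mulAut_ext (by decide +kernel)]
      exact levelTwo.mul_mem (levelTwo.mul_mem (levelTwo.mul_mem (conj_mem _) negAut_mem) iB) iA
    · rw [show transvectAut * dehnB * transvectAut⁻¹ = dehnB from mulAut_ext (by decide +kernel)]
      exact dehnB_mem
    · rw [show transvectAut * negAut * transvectAut⁻¹ = MulAut.conj (of 1)⁻¹ * negAut from
        mulAut_ext (by decide +kernel)]
      exact levelTwo.mul_mem (conj_mem _) negAut_mem

/-- The twelve words which exhaust a group generated by involutions `s`, `n` and a central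
involution `e` such that `(s * n) ^ 3 = e`. -/
def dihedralSet {Q : Type*} [Group Q] (s n e : Q) : Set Q :=
  {q | ∃ k, (k = 1 ∨ k = e) ∧ (q = k ∨ q = s * k ∨ q = n * k ∨ q = s * (n * k) ∨ q = n * (s * k) ∨
    q = s * (n * (s * k)))}

section
variable {Q : Type*} [Group Q] {s n e : Q}

theorem mul_mem_dihedralSet_left (hs : s * s = 1) {q : Q} (hq : q ∈ dihedralSet s n e) :
    s * q ∈ dihedralSet s n e := by
  obtain ⟨k, hk, h⟩ := hq
  have hs' : ∀ x, s * (s * x) = x := fun x => by rw [← mul_assoc, hs, one_mul]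
  refine ⟨k, hk, ?_⟩
  rcases h with rfl | rfl | rfl | rfl | rfl | rfl <;> simp [hs']

theorem mul_mem_dihedralSet_middle (hs : s * s = 1) (hn : n * n = 1)
    (he : e * e = 1) (hes : e * s = s * e)
    (hsn : s * n * (s * n) * (s * n) = e) {q : Q} (hq : q ∈ dihedralSet s n e) :
    n * q ∈ dihedralSet s n e := by
  obtain ⟨k, hk, h⟩ := hq
  have hs' : ∀ x, s * (s * x) = x := fun x => by rw [← mul_assoc, hs, one_mul]
  have hn' : ∀ x, n * (n * x) = x := fun x => by rw [← mul_assoc, hn, one_mul]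
  have h1 : n * s * n = s * n * s * e := by
    rw [← hsn]
    simp only [mul_assoc, hs', hn']
  have h2 : ∀ x, n * (s * (n * x)) = s * (n * (s * (e * x))) := fun x => by
    simpa only [mul_assoc] using congrArg (· * x) h1
  have h3 : ∀ x, e * (s * x) = s * (e * x) := fun x => by
    simpa only [mul_assoc] using congrArg (· * x) hes
  have hk' : e * k = 1 ∨ e * k = e := by
    rcases hk with rfl | rfl
    · exact Or.inr (mul_one _)
    · exact Or.inl he
  rcases h with rfl | rfl | rfl | rfl | rfl | rfl
  · exact ⟨q, hk, by simp⟩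
  · exact ⟨k, hk, by simp⟩
  · exact ⟨k, hk, by simp [hn']⟩
  · exact ⟨e * k, hk', by simp [h2]⟩
  · exact ⟨k, hk, by simp [hn']⟩
  · exact ⟨e * k, hk', by simp [h2, h3, hs']⟩

theorem mul_mem_dihedralSet_right (he : e * e = 1) (hes : e * s = s * e) (hen : e * n = n * e)
    {q : Q} (hq : q ∈ dihedralSet s n e) : e * q ∈ dihedralSet s n e := by
  obtain ⟨k, hk, h⟩ := hq
  have h3 : ∀ x, e * (s * x) = s * (e * x) := fun x => by
    simpa only [mul_assoc] using congrArg (· * x) hes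
  have h4 : ∀ x, e * (n * x) = n * (e * x) := fun x => by
    simpa only [mul_assoc] using congrArg (· * x) hen
  have hk' : e * k = 1 ∨ e * k = e := by
    rcases hk with rfl | rfl
    · exact Or.inr (mul_one _)
    · exact Or.inl he
  refine ⟨e * k, hk', ?_⟩
  rcases h with rfl | rfl | rfl | rfl | rfl | rfl <;> simp [h3, h4]

end

open scoped Pointwise in
/-- Twelve cosets of the level two subgroup exhaust the automorphism group. -/
theorem mk_mem_dihedralSet (φ : MulAut (FreeGroup (Fin 2))) :
    (φ : MulAut (FreeGroup (Fin 2)) ⧸ levelTwo) ∈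
      dihedralSet (swapAut : MulAut (FreeGroup (Fin 2)) ⧸ levelTwo) transvectAut invertAut := by
  set q := QuotientGroup.mk' levelTwo
  have hq : ∀ {a b : MulAut (FreeGroup (Fin 2))}, a⁻¹ * b ∈ levelTwo → q a = q b :=
    fun h => QuotientGroup.eq.mpr h
  have hs : q swapAut * q swapAut = 1 := by rw [← map_mul, swapAut_mul_self, map_one]
  have he : q invertAut * q invertAut = 1 := by rw [← map_mul, invertAut_mul_self, map_one]
  have hn : q transvectAut * q transvectAut = 1 := by
    rw [← map_mul, transvectAut_mul_self]
    exact (QuotientGroup.eq_one_iff _).mpr (levelTwo.inv_mem dehnB_mem)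
  have hes : q invertAut * q swapAut = q swapAut * q invertAut := by
    rw [← map_mul, ← map_mul]
    refine hq ?_
    rw [show (invertAut * swapAut)⁻¹ * (swapAut * invertAut) = negAut from
      mulAut_ext (by decide +kernel)]
    exact negAut_mem
  have hen : q invertAut * q transvectAut = q transvectAut * q invertAut := by
    rw [← map_mul, ← map_mul]
    refine hq ?_
    rw [show (invertAut * transvectAut)⁻¹ * (transvectAut * invertAut) =
      MulAut.conj (of 1)⁻¹ * dehnB from mulAut_ext (by decide +kernel)]
    exact levelTwo.mul_mem (conj_mem _) dehnB_mem
  have hsn : q swapAut * q transvectAut * (q swapAut * q transvectAut) *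
      (q swapAut * q transvectAut) = q invertAut := by
    rw [← map_mul, ← map_mul, ← map_mul]
    refine hq ?_
    rw [← levelTwo.inv_mem_iff, mul_inv_rev, inv_inv]
    refine (Subgroup.Normal.mem_comm_iff inferInstance).mp ?_
    rw [show swapAut * transvectAut * (swapAut * transvectAut) * (swapAut * transvectAut) *
      invertAut⁻¹ = MulAut.conj ((of 0)⁻¹ * (of 0 ^ 2 * of 1)⁻¹ * (of 0 ^ 2 * of 1)⁻¹) *
        (dehnA * dehnB) from mulAut_ext (by decide +kernel)]
    exact levelTwo.mul_mem (conj_mem _) (levelTwo.mul_mem dehnA_mem dehnB_mem)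
  set U := dihedralSet (q swapAut) (q transvectAut) (q invertAut)
  have hstab : ∀ a : MulAut (FreeGroup (Fin 2)) ⧸ levelTwo, a * a = 1 → (∀ b ∈ U, a * b ∈ U) →
      a ∈ MulAction.stabilizer (MulAut (FreeGroup (Fin 2)) ⧸ levelTwo) U := fun a ha h => by
    refine MulAction.mem_stabilizer_set.mpr fun b => ⟨fun hb => ?_, h b⟩
    have := h _ hb
    rwa [smul_eq_mul, ← mul_assoc, ha, one_mul] at this
  have htop := eq_top_of_elementary_mem
    (D := (MulAction.stabilizer (MulAut (FreeGroup (Fin 2)) ⧸ levelTwo) U).comap q)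
    (hstab _ hs fun _ => mul_mem_dihedralSet_left hs)
    (hstab _ he fun _ => mul_mem_dihedralSet_right he hes hen)
    (hstab _ hn fun _ => mul_mem_dihedralSet_middle hs hn he hes hsn)
    fun g => by
      rw [Subgroup.mem_comap, show q (MulAut.conj g) = 1 from
        (QuotientGroup.eq_one_iff _).mpr (conj_mem g)]
      exact Subgroup.one_mem _
  have hφ : φ ∈ (MulAction.stabilizer (MulAut (FreeGroup (Fin 2)) ⧸ levelTwo) U).comap q :=
    htop ▸ Subgroup.mem_top φ
  have h1 : q φ * 1 ∈ U := (MulAction.mem_stabilizer_set.mp hφ 1).mpr ⟨1, Or.inl rfl, Or.inl rfl⟩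
  rwa [mul_one] at h1

/-- The exponent sum of the generator `i`, modulo `m`. -/
def expHom (m : ℕ) (i : Fin 2) : FreeGroup (Fin 2) →* Multiplicative (ZMod m) :=
  lift fun j => Multiplicative.ofAdd (if j = i then 1 else 0)

/-- The action on the abelianization modulo `m`, as a matrix. -/
def expMatrix (m : ℕ) : MulAut (FreeGroup (Fin 2)) →* Matrix (Fin 2) (Fin 2) (ZMod m) where
  toFun φ := Matrix.of fun i j => (expHom m i (φ (of j))).toAdd
  map_one' := by
    ext i j
    simp [expHom, Matrix.one_apply, eq_comm]
  map_mul' φ ψ := by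
    have key : ∀ (i : Fin 2) (w : FreeGroup (Fin 2)), (expHom m i (φ w)).toAdd =
        ∑ k, (expHom m i (φ (of k))).toAdd * (expHom m k w).toAdd := fun i w => by
      induction w with
      | C1 => simp
      | of j => simp [expHom]
      | inv_of j h => simp only [map_inv, toAdd_inv, h, mul_neg, Finset.sum_neg_distrib]
      | mul g h hg hh => simp only [map_mul, toAdd_mul, hg, hh, mul_add, Finset.sum_add_distrib]
    ext i j
    simp only [Matrix.mul_apply, Matrix.of_apply, MulAut.mul_apply]
    exact key i _

/-- The automorphisms which are trivial modulo `2` and have determinant `1` on the abelianization.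
The determinant is taken modulo `4`, which suffices to tell `1` from `-1`. -/
def levelTwoDetOne : Subgroup (MulAut (FreeGroup (Fin 2))) :=
  (expMatrix 2).ker ⊓ (Matrix.detMonoidHom.comp (expMatrix 4)).ker

theorem mem_levelTwoDetOne (φ : MulAut (FreeGroup (Fin 2))) : φ ∈ levelTwoDetOne ↔
    expMatrix 2 φ = 1 ∧ (expMatrix 4 φ).det = 1 := Iff.rfl

instance (φ : MulAut (FreeGroup (Fin 2))) : Decidable (φ ∈ levelTwoDetOne) :=
  decidable_of_iff _ (mem_levelTwoDetOne φ).symm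

theorem levelTwo_le : levelTwo ≤ levelTwoDetOne := by
  refine (Subgroup.closure_le _).mpr ?_
  rintro s ((rfl | rfl | rfl) | ⟨g, rfl⟩)
  · exact (by decide +kernel : dehnA ∈ levelTwoDetOne)
  · exact (by decide +kernel : dehnB ∈ levelTwoDetOne)
  · exact (by decide +kernel : negAut ∈ levelTwoDetOne)
  · have h : ∀ m, expMatrix m (MulAut.conj g) = 1 := fun m => by
      ext i j
      simp [expMatrix, expHom, Matrix.one_apply, eq_comm]
    exact (mem_levelTwoDetOne _).mpr ⟨h 2, by rw [h 4, Matrix.det_one]⟩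

theorem levelTwo_eq : levelTwo = levelTwoDetOne := by
  refine le_antisymm levelTwo_le fun φ hφ => ?_
  obtain ⟨k, hk, h⟩ := mk_mem_dihedralSet φ
  have hτ : ∀ τ : MulAut (FreeGroup (Fin 2)), (φ : MulAut (FreeGroup (Fin 2)) ⧸ levelTwo) = τ →
      τ ∈ levelTwoDetOne := fun τ h => by
    have := levelTwo_le (QuotientGroup.eq.mp h.symm)
    simpa using levelTwoDetOne.mul_mem hφ (levelTwoDetOne.inv_mem this)
  rcases hk with rfl | rfl
  · rcases h with h | h | h | h | h | h
    · exact (QuotientGroup.eq_one_iff _).mp h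
    · exact absurd (hτ (swapAut * 1) h) (by decide +kernel)
    · exact absurd (hτ (transvectAut * 1) h) (by decide +kernel)
    · exact absurd (hτ (swapAut * (transvectAut * 1)) h) (by decide +kernel)
    · exact absurd (hτ (transvectAut * (swapAut * 1)) h) (by decide +kernel)
    · exact absurd (hτ (swapAut * (transvectAut * (swapAut * 1))) h) (by decide +kernel)
  · rcases h with h | h | h | h | h | h
    · exact absurd (hτ invertAut h) (by decide +kernel)
    · exact absurd (hτ (swapAut * invertAut) h) (by decide +kernel)
    · exact absurd (hτ (transvectAut * invertAut) h) (by decide +kernel)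
    · exact absurd (hτ (swapAut * (transvectAut * invertAut)) h) (by decide +kernel)
    · exact absurd (hτ (transvectAut * (swapAut * invertAut)) h) (by decide +kernel)
    · exact absurd (hτ (swapAut * (transvectAut * (swapAut * invertAut))) h) (by decide +kernel)

/-- Up to four cosets, given by inner automorphisms, the level two subgroup is the image of the
extension `BraidExt`. -/
theorem exists_eq_braidHom_mul_conj {φ : MulAut (FreeGroup (Fin 2))} (hφ : φ ∈ levelTwo) :
    ∃ g : BraidExt, ∃ τ ∈ ({1, of 0, of 1, of 0 * of 1} : Set (FreeGroup (Fin 2))),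
      φ = braidHom g * MulAut.conj τ := by
  have hnormal : (MulAut.conj (G := FreeGroup (Fin 2))).range.Normal := by
    refine ⟨?_⟩
    rintro _ ⟨w, rfl⟩ ψ
    exact ⟨ψ w, (mul_conj_mul_inv ψ w).symm⟩
  have hle : levelTwo ≤ braidHom.range ⊔ (MulAut.conj (G := FreeGroup (Fin 2))).range := by
    have hl : ∀ n, fiberHom n ∈ braidHom.range ⊔ (MulAut.conj (G := FreeGroup (Fin 2))).range :=
      fun n => Subgroup.mem_sup_left ⟨inl n, SemidirectProduct.lift_inl ..⟩
    have hr : ∀ f, baseHom f ∈ braidHom.range ⊔ (MulAut.conj (G := FreeGroup (Fin 2))).range :=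
      fun f => Subgroup.mem_sup_left ⟨inr f, SemidirectProduct.lift_inr ..⟩
    have hc : ∀ g, MulAut.conj g ∈ braidHom.range ⊔ (MulAut.conj (G := FreeGroup (Fin 2))).range :=
      fun g => Subgroup.mem_sup_right ⟨g, rfl⟩
    refine (Subgroup.closure_le _).mpr ?_
    rintro s ((rfl | rfl | rfl) | ⟨g, rfl⟩)
    · rw [SetLike.mem_coe]
      simpa [fiberHom, baseHom] using mul_mem (hr (of 1)) (hl (of 1))
    · simpa [fiberHom, baseHom] using mul_mem (hr (of 0)) (hl (of 2))
    · rw [SetLike.mem_coe]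
      have h1 : fiberHom (of 0) = MulAut.conj (of 0 * (of 1)⁻¹) * negAut := by
        simp only [fiberHom, punctureP, lift_apply_of, Matrix.cons_val_zero]
      have h2 := mul_mem (hc (of 0 * (of 1)⁻¹)⁻¹) (hl (of 0))
      rwa [h1, map_inv, inv_mul_cancel_left] at h2
    · exact hc g
  obtain ⟨_, ⟨g, rfl⟩, _, ⟨w, rfl⟩, rfl⟩ := Subgroup.mem_sup_of_normal_right.mp (hle hφ)
  obtain ⟨τ, hτ, n, hn⟩ := exists_conj_eq_punctureAut_mul_conj w
  refine ⟨g * punctureHom n, τ, hτ, ?_⟩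
  rw [hn, map_mul, ← braidHom_comp_punctureHom, mul_assoc]
  rfl

/-! ### The congruence subgroup property -/

open CongruenceSubgroupProblem

theorem exists_principalCongruenceSubgroup_le_levelTwo :
    ∃ (M : Subgroup (FreeGroup (Fin 2))) (_ : M.Characteristic),
      M.FiniteIndex ∧ principalCongruenceSubgroup M ≤ levelTwo := by
  set K : Subgroup (FreeGroup (Fin 2)) :=
    ((expHom 2 0).ker ⊓ (expHom 2 1).ker) ⊓ ((expHom 4 0).ker ⊓ (expHom 4 1).ker) with hK
  refine ⟨charCore K, inferInstance, inferInstance, fun φ hφ => ?_⟩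
  have h := fun g => charCore_le _ (mem_principalCongruenceSubgroup_iff.mp hφ g)
  have h1 : ∀ m i j, φ (of j) * (of j)⁻¹ ∈ (expHom m i).ker →
      expMatrix m φ i j = (1 : Matrix (Fin 2) (Fin 2) (ZMod m)) i j := fun m i j h => by
    rw [MonoidHom.mem_ker, map_mul, map_inv, mul_inv_eq_one] at h
    rw [← map_one (expMatrix m)]
    exact congrArg Multiplicative.toAdd h
  have h2 : expMatrix 2 φ = 1 := by
    ext i j
    fin_cases i
    exacts [h1 2 0 j (h _).1.1, h1 2 1 j (h _).1.2]
  have h4 : expMatrix 4 φ = 1 := by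
    ext i j
    fin_cases i
    exacts [h1 4 0 j (h _).2.1, h1 4 1 j (h _).2.2]
  rw [levelTwo_eq]
  exact (mem_levelTwoDetOne _).mpr ⟨h2, by rw [h4, Matrix.det_one]⟩

instance : (punctureAut.range.comap (MulAut.conj (G := FreeGroup (Fin 2)))).FiniteIndex := by
  set K := punctureAut.range.comap (MulAut.conj (G := FreeGroup (Fin 2)))
  have : Finite (FreeGroup (Fin 2) ⧸ K) := by
    refine Finite.of_surjective
      (fun τ : ({1, of 0, of 1, of 0 * of 1} : Set (FreeGroup (Fin 2))) =>
        (((τ : FreeGroup (Fin 2))⁻¹ : FreeGroup (Fin 2)) : FreeGroup (Fin 2) ⧸ K)) fun q => ?_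
    obtain ⟨w, rfl⟩ := QuotientGroup.mk_surjective q
    obtain ⟨τ, hτ, n, hn⟩ := exists_conj_eq_punctureAut_mul_conj w⁻¹
    refine ⟨⟨τ, hτ⟩, QuotientGroup.eq.mpr (show MulAut.conj _ ∈ punctureAut.range from ⟨n⁻¹, ?_⟩)⟩
    rw [map_inv, eq_mul_inv_of_mul_eq hn.symm]
    simp
  exact Subgroup.finiteIndex_of_finite_quotient

/-- The preimage of a finite index subgroup has finite index. -/
instance {G G' : Type*} [Group G] [Group G'] (f : G →* G') (H : Subgroup G') [H.FiniteIndex] :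
    (H.comap f).FiniteIndex :=
  ⟨by
    rw [Subgroup.index_comap]
    exact mt (Subgroup.relIndex_eq_zero_of_le_right le_top)
      (by rw [Subgroup.relIndex_top_right]; exact Subgroup.FiniteIndex.index_ne_zero)⟩

/-- A finite index subgroup `P` of the extension is detected, on pushes of the base point which act
as inner automorphisms, by a finite index characteristic subgroup of the free group. -/
theorem exists_characteristic_lift (P : Subgroup BraidExt) [P.FiniteIndex] :
    ∃ (M : Subgroup (FreeGroup (Fin 2))) (_ : M.Characteristic), M.FiniteIndex ∧
      ∀ n, ∀ m ∈ M, punctureAut n = MulAut.conj m → punctureHom n ∈ P := by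
  set A := (P.comap punctureHom).map punctureAut
  set K := punctureAut.range.comap (MulAut.conj (G := FreeGroup (Fin 2)))
  set M := A.comap (MulAut.conj (G := FreeGroup (Fin 2)))
  have h1 : A.relIndex punctureAut.range ≠ 0 := by
    rw [MonoidHom.range_eq_map, Subgroup.relIndex_map_map_of_injective _ _ punctureAut_injective,
      Subgroup.relIndex_top_right]
    exact Subgroup.FiniteIndex.index_ne_zero
  have h2 : M.relIndex K ≠ 0 := by
    rw [Subgroup.relIndex_comap]
    exact mt (Subgroup.relIndex_eq_zero_of_le_right (Subgroup.map_comap_le _ _)) h1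
  have h3 : M ≤ K := Subgroup.comap_mono (Subgroup.map_le_range _ _)
  have : M.FiniteIndex := ⟨by
    rw [← Subgroup.relIndex_mul_index h3]
    exact mul_ne_zero h2 Subgroup.FiniteIndex.index_ne_zero⟩
  refine ⟨charCore M.normalCore, inferInstance, inferInstance, fun n m hm hn => ?_⟩
  obtain ⟨n', hn', h⟩ := M.normalCore_le (charCore_le _ hm)
  rw [← hn] at h
  rwa [← punctureAut_injective h]

/-- The elements of the extension whose component in the fibre lies in the characteristic subgroup
`M`. -/
def leftSubgroup (M : Subgroup (FreeGroup (Fin 3))) [hM : M.Characteristic] :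
    Subgroup BraidExt where
  carrier := {e | e.left ∈ M}
  one_mem' := M.one_mem
  mul_mem' {a b} ha hb := M.mul_mem ha <| by
    exact (SetLike.ext_iff.mp (hM.fixed (monodromy a.right)) b.left).mpr hb
  inv_mem' {a} ha := by
    exact (SetLike.ext_iff.mp (hM.fixed (monodromy a.right⁻¹)) a.left⁻¹).mpr (M.inv_mem ha)

theorem inv_mul_mem_leftSubgroup_iff {M : Subgroup (FreeGroup (Fin 3))} [hM : M.Characteristic]
    {a b : BraidExt} : a⁻¹ * b ∈ leftSubgroup M ↔ a.left⁻¹ * b.left ∈ M := by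
  have h1 : (a⁻¹ * b).left = monodromy a.right⁻¹ (a.left⁻¹ * b.left) := by simp
  change (a⁻¹ * b).left ∈ M ↔ _
  rw [h1]
  exact SetLike.ext_iff.mp (hM.fixed (monodromy a.right⁻¹)) (a.left⁻¹ * b.left)

instance (M : Subgroup (FreeGroup (Fin 3))) [hM : M.Characteristic] [M.FiniteIndex] :
    (leftSubgroup M).FiniteIndex := by
  have : Finite (BraidExt ⧸ leftSubgroup M) := by
    refine Finite.of_injective (β := FreeGroup (Fin 3) ⧸ M)
      (Quotient.lift (fun e : BraidExt => (e.left : FreeGroup (Fin 3) ⧸ M)) fun a b h => ?_) ?_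
    · exact QuotientGroup.eq.mpr
        (inv_mul_mem_leftSubgroup_iff.mp (QuotientGroup.leftRel_apply.mp h))
    · rintro ⟨a⟩ ⟨b⟩ h
      exact QuotientGroup.eq.mpr (inv_mul_mem_leftSubgroup_iff.mpr (QuotientGroup.eq.mp h))
  exact Subgroup.finiteIndex_of_finite_quotient

/-- An element of the extension which, modulo a suitable finite index subgroup, commutes with the
pushes of the base point lies in a given finite index normal subgroup. The four pushes
which are used act as inner automorphisms: they are squares of the loops around the second puncture
in the base and around the first puncture in the fibre, and one conjugate of each. -/
theorem exists_commutator_detection (H : Subgroup BraidExt) [H.Normal] [H.FiniteIndex] :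
    ∃ P : Subgroup BraidExt, P.FiniteIndex ∧ ∀ g, (∀ n w, punctureAut n = MulAut.conj w →
      g * punctureHom n * g⁻¹ * (punctureHom n)⁻¹ ∈ P) → g ∈ H := by
  obtain ⟨M, -, _, _, hM'⟩ := exists_normal_commute_imp_mem (H.comap inl)
    (show (0 : Fin 3) ≠ 1 by decide) two_ne_zero
  set C := charCore M
  set L := H.comap inr ⊓ ((quotientAut C).comp monodromy).ker with hL
  have : Finite (MulAut (FreeGroup (Fin 3) ⧸ C)) := Finite.of_injective _ DFunLike.coe_injective
  obtain ⟨L', -, _, _, hL'⟩ := exists_normal_commute_imp_mem L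
    (show (0 : Fin 2) ≠ 1 by decide) two_ne_zero
  refine ⟨L'.comap rightHom ⊓ leftSubgroup C, inferInstance, fun g hg => ?_⟩
  have hg' : ∀ z ∈ punctureHom.range, (∃ w, braidHom z = MulAut.conj w) →
      g * z * g⁻¹ * z⁻¹ ∈ L'.comap rightHom ⊓ leftSubgroup C := by
    rintro _ ⟨n, rfl⟩ ⟨w, hw⟩
    exact hg n w (by rw [← hw, ← braidHom_comp_punctureHom]; rfl)
  have hconj : ∀ z e : BraidExt, (∃ w, braidHom z = MulAut.conj w) →
      ∃ w, braidHom (e * z * e⁻¹) = MulAut.conj w := by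
    rintro z e ⟨w, hw⟩
    exact ⟨braidHom e w, by rw [map_mul, map_mul, map_inv, hw, mul_conj_mul_inv]⟩
  have hu : (inr (of 0 ^ 2) : BraidExt) ∈ punctureHom.range := ⟨of 1 ^ 2, by simp [punctureHom]⟩
  have ht : (inl (of 0 ^ 2) : BraidExt) ∈ punctureHom.range := ⟨of 0 ^ 2, by simp [punctureHom]⟩
  have hu' : ∃ w, braidHom (inr (of 0 ^ 2)) = MulAut.conj w :=
    ⟨of 1 * of 0 * (of 1)⁻¹ * (of 0)⁻¹, mulAut_ext (by decide +kernel)⟩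
  have ht' : ∃ w, braidHom (inl (of 0 ^ 2)) = MulAut.conj w :=
    ⟨of 0 * (of 1)⁻¹ * (of 0)⁻¹ * of 1, mulAut_ext (by decide +kernel)⟩
  have hnor : punctureHom.range.Normal := inferInstance
  -- The commutators with elements of the base put the component of `g` in the base into `L`, so
  -- that it acts trivially on the fibre modulo `C`.
  have hf : g.right ∈ L := by
    refine hL' _ ?_ ?_
    · exact (hg' _ hu hu').1
    · exact (hg' _ (hnor.conj_mem _ hu (inr (of 1))) (hconj _ _ hu')).1
  have hact : ∀ z, monodromy g.right z * z⁻¹ ∈ C :=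
    mem_principalCongruenceSubgroup_iff.mp hf.2
  have hleft : ∀ z, g * inl z * g⁻¹ * (inl z)⁻¹ ∈ leftSubgroup C →
      g.left * z * g.left⁻¹ * z⁻¹ ∈ M := fun z hz => by
    have h1 : (g * inl z * g⁻¹ * (inl z)⁻¹).left =
        g.left * (monodromy g.right z * z⁻¹) * g.left⁻¹ * (g.left * z * g.left⁻¹ * z⁻¹) := by
      simp [mul_assoc]
    have h2 : (g * inl z * g⁻¹ * (inl z)⁻¹).left ∈ C := hz
    rw [h1] at h2
    have h3 : C.Normal := inferInstance
    exact charCore_le _ ((C.mul_mem_cancel_left (h3.conj_mem _ (hact z) _)).mp h2)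
  have hn : g.left ∈ H.comap inl := by
    refine hM' _ ?_ ?_
    · exact hleft _ (hg' _ ht ht').2
    · refine hleft _ ?_
      simpa using (hg' _ (hnor.conj_mem _ ht (inl (of 1))) (hconj _ _ ht')).2
  rw [← SemidirectProduct.inl_left_mul_inr_right g]
  exact H.mul_mem hn hf.1

/-- Every finite index subgroup contains a principal congruence subgroup. -/
theorem exists_principalCongruenceSubgroup_le
    {H : Subgroup (MulAut (FreeGroup (Fin 2)))} [H.FiniteIndex] :
    ∃ (M : Subgroup (FreeGroup (Fin 2))) (_ : M.Characteristic),
      M.FiniteIndex ∧ principalCongruenceSubgroup M ≤ H := by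
  obtain ⟨P, _, hP⟩ := exists_commutator_detection (H.normalCore.comap braidHom)
  obtain ⟨M₁, _, _, hM₁⟩ := exists_principalCongruenceSubgroup_le_levelTwo
  obtain ⟨M₂, _, _, hM₂⟩ := exists_characteristic_lift
    (P ⊓ (((expHom 3 0).comp rightHom).ker ⊓ ((expHom 3 1).comp rightHom).ker))
  refine ⟨charCore (M₁ ⊓ M₂), inferInstance, inferInstance, fun φ hφ => ?_⟩
  have h₁ : charCore (M₁ ⊓ M₂) ≤ M₁ := (charCore_le _).trans inf_le_left
  have h₂ : charCore (M₁ ⊓ M₂) ≤ M₂ := (charCore_le _).trans inf_le_right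
  obtain ⟨g, τ, hτ, hg⟩ := exists_eq_braidHom_mul_conj
    (hM₁ (principalCongruenceSubgroup_mono h₁ hφ))
  -- As `φ` is trivial modulo `M₂`, the elements `g * punctureHom n' * g⁻¹` and `punctureHom n` act
  -- by conjugation by `φ w` and by `w`, which agree modulo `M₂`.
  have hcomm : ∀ n n' w, punctureAut n = MulAut.conj w →
      punctureAut n' = MulAut.conj (τ * w * τ⁻¹) → g * punctureHom n' * g⁻¹ * (punctureHom n)⁻¹ ∈
      P ⊓ (((expHom 3 0).comp rightHom).ker ⊓ ((expHom 3 1).comp rightHom).ker) := by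
    intro n n' w hn hn'
    have hnor : punctureHom.range.Normal := inferInstance
    have hP : ∀ n, braidHom (punctureHom n) = punctureAut n := fun n => by
      rw [← braidHom_comp_punctureHom]; rfl
    obtain ⟨k, hk⟩ : g * punctureHom n' * g⁻¹ * (punctureHom n)⁻¹ ∈ punctureHom.range :=
      mul_mem (hnor.conj_mem _ ⟨n', rfl⟩ g) (inv_mem ⟨n, rfl⟩)
    rw [← hk]
    refine hM₂ k (φ w * w⁻¹) (h₂ (mem_principalCongruenceSubgroup_iff.mp hφ w)) ?_
    have h4 := mul_conj_mul_inv φ w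
    rw [← hP, hk, map_mul (f := MulAut.conj), ← h4, hg]
    simp only [map_mul, map_inv, hP, hn, hn']
    group
  -- Conjugation by `τ ≠ 1` moves the loop around the first puncture, which is trivial in the base,
  -- to a loop around another puncture, whose square is nontrivial in the base modulo `3`.
  have hτ1 : τ = 1 := by
    have ht : punctureAut (of 0 ^ 2) = MulAut.conj (of 0 * (of 1)⁻¹ * (of 0)⁻¹ * of 1) :=
      mulAut_ext (by decide +kernel)
    have hχ : ∀ (χ : BraidExt →* Multiplicative (ZMod 3)) {a b : BraidExt},
        g * a * g⁻¹ * b⁻¹ ∈ χ.ker → χ a = χ b := fun χ a b h => by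
      rw [MonoidHom.mem_ker, map_mul, map_mul, map_mul, map_inv, map_inv, mul_comm (χ g),
        mul_inv_cancel_right, mul_inv_eq_one] at h
      exact h
    rcases hτ with rfl | rfl | rfl | rfl
    · rfl
    · exact absurd (hχ _ (hcomm _ (of 0 * of 2 ^ 2 * (of 0)⁻¹) _ ht
        (mulAut_ext (by decide +kernel))).2.2) (by decide +kernel)
    · exact absurd (hχ _ (hcomm _ (of 1 ^ 2) _ ht
        (mulAut_ext (by decide +kernel))).2.1) (by decide +kernel)
    · exact absurd (hχ _ (hcomm _ (((of 1)⁻¹ * (of 2)⁻¹ * (of 0)⁻¹) ^ 2) _ ht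
        (mulAut_ext (by decide +kernel))).2.1) (by decide +kernel)
  subst hτ1
  rw [hg, map_one, mul_one]
  refine H.normalCore_le (hP g fun n w hn => (hcomm n n w hn ?_).1)
  simpa using hn

theorem hasCongruenceSubgroupProperty : HasCongruenceSubgroupProperty (FreeGroup (Fin 2)) :=
  fun _ hH => ⟨hH, exists_principalCongruenceSubgroup_le⟩

end FreeGroupTwo

namespace CongruenceSubgroupProblem

/-- The congruence subgroup property makes the congruence kernel trivial: an element of the kernel
has, in each finite quotient by a principal congruence subgroup, a representative which is trivial
modulo that subgroup. -/
theorem HasCongruenceSubgroupProperty.congruenceKernel_eq_bot {Γ : Type*} [Group Γ] [Group.FG Γ]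
    (h : HasCongruenceSubgroupProperty Γ) : congruenceKernel Γ = ⊥ := by
  refine (Subgroup.eq_bot_iff_forall _).mpr fun x hx => proj_ext fun N _ _ => ?_
  obtain ⟨-, M, hchar, _, hM⟩ := h N inferInstance
  obtain ⟨φ, hφ⟩ := exists_rep (principalCongruenceSubgroup M) x
  have hφM : φ ∈ principalCongruenceSubgroup M := by
    refine mem_principalCongruenceSubgroup_iff.mpr fun g => ?_
    have h1 : M ≤ charCore M := fun m hm => mem_charCore.mpr fun ψ =>
      (SetLike.ext_iff.mp (hchar.fixed ψ) m).mpr hm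
    have h2 := proj_act_of_rep (N := M) h1 hφ (proj_toCompletion M g)
    have h3 : act x (toCompletion Γ g) = toCompletion Γ g :=
      DFunLike.congr_fun (show completionAutMap Γ x = 1 from hx) (toCompletion Γ g)
    rw [h3, proj_toCompletion] at h2
    rw [← QuotientGroup.eq_one_iff, QuotientGroup.mk_mul, QuotientGroup.mk_inv, ← h2,
      mul_inv_cancel]
  rw [proj_eq_of_le hM hφ, map_one]
  exact (QuotientGroup.eq_one_iff _).mpr (hM hφM)

end CongruenceSubgroupProblem

theorem theorem1p1 :
    CongruenceSubgroupProblem.congruenceKernel (FreeGroup (Fin 2)) = ⊥ ∧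
    CongruenceSubgroupProblem.HasCongruenceSubgroupProperty (FreeGroup (Fin 2)) ∧
    Function.Injective
      (CongruenceSubgroupProblem.completionAutMap (FreeGroup (Fin 2))) := by
  have h := FreeGroupTwo.hasCongruenceSubgroupProperty
  exact ⟨h.congruenceKernel_eq_bot, h, (MonoidHom.ker_eq_bot_iff _).mp h.congruenceKernel_eq_bot⟩
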